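/- **Definitions.** Let $f:\{0,1\}^n\to\{0,1\}$. Call $f$ a *monotone decision list* if there are a permutation $\pi$ of $[n]$ and $\nu\in\{0,1\}^{n+1}$ such that $f(x)=\nu_j$ for the smallest $j\in[n]$ with $x_{\pi(j)}=1$, and $f(0^n)=\nu_{n+1}$. Call $f$ a *decision list* if $x\mapsto f(x\oplus r)$ is a monotone decision list for some $r\in\{0,1\}^n$, and a *linear threshold function* if there are $w\in\mathbb R^n$, $\theta\in\mathbb R$ with $f(x)=1\iff \sum_i w_ix_i\ge\theta$. For a probability distribution $\mathcal D$ on $\{0,1\}^n$ and a class $\mathfrak C$ of Boolean functions on $\{0,1\}^n$, $f$ is *$\varepsilon$-far from $\mathfrak C$ under $\mathcal D$* if $\Pr_{x\sim\mathcal D}[f(x)\ne g(x)]\ge\varepsilon$ for every $g\in\mathfrak C$. Algorithms are randomized and adaptive; they access an unknown pair $(f,\mathcal D)$ through an oracle that returns independent samples $x\sim\mathcal D$ and an oracle that returns $f(x)$ on a queried $x\in\{0,1\}^n$, and they accept or reject. A *distribution-free tester* for $\mathfrak C$ with distance parameter $\varepsilon$ is such an algorithm that, for all $(f,\mathcal D)$,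 accepts with probability at least $2/3$ if $f\in\mathfrak C$ and rejects with probability at least $2/3$ if $f$ is $\varepsilon$-far from $\mathfrak C$ under $\mathcal D$. **Theorem.** There are an absolute constant $c>0$ and an $N$ such that for all $n\ge N$ and all $0<\varepsilon\le 1/4$ the following hold. 1. Let $\mathsf{ALG}$ be a randomized algorithm that for every $f:\{0,1\}^n\to\{0,1\}$ and every distribution $\mathcal D$ over $\{0,1\}^n$ takes at most $m$ samples from $\mathcal D$ and makes at most $M$ queries to $f$, such that it accepts with probability at least $5/6$ whenever $f$ is a monotone decision list, and rejects with probability at least $5/6$ whenever $f$ is $\varepsilon$-far from linear threshold functions under $\mathcal D$. Then $m+M\ge c\,\sqrt n/\log n$. 2. Every distribution-free tester for decision lists with distance parameter $\varepsilon$ for which the number of samples plus the number of queries is always at most $t$ satisfies $t\ge c\,\sqrt n/\log n$. 3. The same holds for every distribution-free tester for monotone decision lists. In particular, distribution-free testing of decision lists, and of monotone decision lists, requires $\tilde\Omega(\sqrt n)$ queries (samples included). -/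

import Mathlib

/-- Boolean functions `{0,1}^n → {0,1}`; `true` is `1` and `false` is `0`. -/
abbrev BoolFn (n : ℕ) : Type := (Fin n → Bool) → Bool

/-- The monotone decision list represented by `(π, ν)` is `f`: `f x = ν_j` for the smallest `j`
with `x_{π(j)} = 1`, and `f x` is the last entry of `ν` if `x = 0^n`. -/
def RepresentsMonoDL {n : ℕ} (π : Equiv.Perm (Fin n)) (ν : Fin (n + 1) → Bool)
    (f : BoolFn n) : Prop :=
  ∀ x : Fin n → Bool,
    (∀ j : Fin n, x (π j) = true → (∀ i : Fin n, i < j → x (π i) = false) →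
      f x = ν j.castSucc) ∧
    ((∀ i : Fin n, x i = false) → f x = ν (Fin.last n))

/-- The class of monotone decision lists over `{0,1}^n`. -/
def MonoDL (n : ℕ) : Set (BoolFn n) :=
  {f | ∃ (π : Equiv.Perm (Fin n)) (ν : Fin (n + 1) → Bool), RepresentsMonoDL π ν f}

/-- The class of decision lists over `{0,1}^n`: those `f` for which `x ↦ f (x ⊕ r)` is a monotone
decision list for some `r`. -/
def DecisionLists (n : ℕ) : Set (BoolFn n) :=
  {f | ∃ r : Fin n → Bool, (fun x : Fin n → Bool => f (fun i => xor (x i) (r i))) ∈ MonoDL n}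

/-- The class of linear threshold functions over `{0,1}^n`. -/
def LinearThresholdFns (n : ℕ) : Set (BoolFn n) :=
  {f | ∃ (w : Fin n → ℝ) (θ : ℝ), ∀ x : Fin n → Bool,
    f x = true ↔ θ ≤ ∑ i : Fin n, w i * (if x i then 1 else 0)}

/-- `Pr_{x ∼ D} [f x ≠ g x]`. -/
noncomputable def distUnder {n : ℕ} (D : PMF (Fin n → Bool)) (f g : BoolFn n) : ENNReal :=
  D.toOuterMeasure {x | f x ≠ g x}

/-- The distance between `f` and the class `C` with respect to `D`. -/
noncomputable def distToClass {n : ℕ} (D : PMF (Fin n → Bool)) (f : BoolFn n)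
    (C : Set (BoolFn n)) : ENNReal :=
  ⨅ g ∈ C, distUnder D f g

/-- `f` is `ε`-far from `C` with respect to `D`. -/
def IsFar {n : ℕ} (ε : ℝ) (D : PMF (Fin n → Bool)) (f : BoolFn n) (C : Set (BoolFn n)) : Prop :=
  ENNReal.ofReal ε ≤ distToClass D f C

/-- Deterministic adaptive algorithms over `{0,1}^n` with a sampling oracle and a query oracle.
At each point of its execution the algorithm halts with an answer (`true` is accept, `false` is
reject), or draws a fresh sample, or queries the unknown function, and it goes on depending on
everything that it has seen so far. -/
inductive DetAlg (n : ℕ) : Type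
  | halt (answer : Bool) : DetAlg n
  | sample (next : (Fin n → Bool) → DetAlg n) : DetAlg n
  | query (q : Fin n → Bool) (next : Bool → DetAlg n) : DetAlg n

/-- The distribution of the answer when the samples are drawn independently from `D` and the
queries are answered by `f`. -/
noncomputable def DetAlg.run {n : ℕ} (f : BoolFn n) (D : PMF (Fin n → Bool)) :
    DetAlg n → PMF Bool
  | .halt b => PMF.pure b
  | .sample next => D.bind (fun x => DetAlg.run f D (next x))
  | .query q next => DetAlg.run f D (next (f q))

/-- The largest total cost of an execution on `f`, over all outcomes of the samples, where each
sample costs `s` and each query costs `q`. -/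
def DetAlg.maxCost {n : ℕ} (s q : ℕ) (f : BoolFn n) : DetAlg n → ℕ
  | .halt _ => 0
  | .sample next => s + Finset.univ.sup (fun x => DetAlg.maxCost s q f (next x))
  | .query x next => q + DetAlg.maxCost s q f (next (f x))

/-- A randomized algorithm is a probability distribution over deterministic ones. (The type
`DetAlg n` is countable, so every such distribution is a `PMF`.) -/
abbrev RandAlg (n : ℕ) : Type := PMF (DetAlg n)

/-- The distribution of the answer, over the internal randomness and the samples. -/
noncomputable def RandAlg.run {n : ℕ} (A : RandAlg n) (f : BoolFn n) (D : PMF (Fin n → Bool)) :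
    PMF Bool :=
  PMF.bind A (fun T => T.run f D)

/-- On every function, `A` always takes at most `m` samples. -/
def RandAlg.SamplesAtMost {n : ℕ} (A : RandAlg n) (m : ℕ) : Prop :=
  ∀ T ∈ PMF.support A, ∀ f : BoolFn n, T.maxCost 1 0 f ≤ m

/-- On every function, `A` always makes at most `M` queries to the function. -/
def RandAlg.QueriesAtMost {n : ℕ} (A : RandAlg n) (M : ℕ) : Prop :=
  ∀ T ∈ PMF.support A, ∀ f : BoolFn n, T.maxCost 0 1 f ≤ M

/-- On every function, the number of samples plus the number of queries of `A` is always at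
most `t`. -/
def RandAlg.TotalAtMost {n : ℕ} (A : RandAlg n) (t : ℕ) : Prop :=
  ∀ T ∈ PMF.support A, ∀ f : BoolFn n, T.maxCost 1 1 f ≤ t

/-- For every function `f` and every distribution `D`, the algorithm `A` accepts with probability
at least `p` if `f ∈ C`, and rejects with probability at least `p` if `f` is `ε`-far from `C'` with
respect to `D`. -/
def RandAlg.Separates {n : ℕ} (A : RandAlg n) (C C' : Set (BoolFn n)) (ε : ℝ) (p : ENNReal) :
    Prop :=
  ∀ (f : BoolFn n) (D : PMF (Fin n → Bool)),
    (f ∈ C → p ≤ A.run f D true) ∧ (IsFar ε D f C' → p ≤ A.run f D false)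

/-- `A` is a (two-sided, adaptive) distribution-free testing algorithm for the class `C` with
distance parameter `ε`. -/
def RandAlg.IsDistFreeTester {n : ℕ} (A : RandAlg n) (C : Set (BoolFn n)) (ε : ℝ) : Prop :=
  A.Separates C C ε (2 / 3)

/-!
The lower bound compares two random functions on `{0,1}^n` under the same distribution of samples.
A uniformly random permutation `σ` puts the variables into slots. The slots from `4K` on, with
`K = n / 8`, are *decoys*: a point that contains a decoy has value `1`. The other slots form `K`
blocks of four, and the value of a decoy-free point is a function of the labels that it contains in
the last block that it meets. With `listRule` on the labels the result `listFn` is a monotone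
decision list. With `cyclicRule` the labels beat one another in a cycle `3 > 2 > 0 > 1 > 3`, and the
result `cyclicFn` has values `1, 1, 0, 0` on four points `a, b, c, d` with `a + b = c + d` inside each
block. No linear threshold function and no decision list has such values, so that `cyclicFn` is
`1/4`-far from these classes under the uniform distribution `pairDist` on the `4K` points
(`isFar_cyclicFn`).

The two functions look the same as long as all variables seen in a block come from a single sample.
Indeed both rules agree on single labels, and for one sampled pair per block the exchange of the
labels `0` and `3` in that block turns the view of one function into an equally likely view of the
other (`Hidden`, `sum_acceptProb_retwist`). An algorithm of cost `t` has little chance to see more: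
the variables of a query may be revealed one at a time until a decoy shows up, which determines the
answer. Every new variable is a decoy with probability at least `1/3`, so that a query reveals a
bounded number of variables on average, and while fewer than `s = √n / 4` variables are revealed, a
new one falls into a block met before with probability at most `1/s`. The induction over the
algorithm (`indistinguishable`) carries the bound `(|P| + 6r) / s` for the advantage, where `P` is
the set of revealed variables and `r` the remaining cost; at `|P| ≥ s` the bound is trivial. What is
revealed never distinguishes between the remaining variables, so that the conditional distribution
of `σ` is uniform on a set that is closed under exchanges of unrevealed variables (`SwapClosed`);
this replaces conditional probabilities by counting. Altogether the advantage is at most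
`24t / √n`, while a tester needs `1/3`. This gives `t ≥ √n / 72`, even without the logarithm.
-/

/-! ### The hidden structure and the two functions -/

/-- The index of the last block met by `x`, where variable `i` sits in slot `σ i` and block `j`
consists of the slots `4j, …, 4j+3`. It is `0` if `x = 0`. -/
def topBlock {n : ℕ} (σ : Equiv.Perm (Fin n)) (x : Fin n → Bool) : ℕ :=
  Finset.univ.sup fun i => if x i then (σ i).val / 4 else 0

/-- The set of labels `ℓ` such that `x` contains the variable in slot `4j+ℓ`. -/
def labels {n : ℕ} (σ : Equiv.Perm (Fin n)) (x : Fin n → Bool) (j : ℕ) : Fin 4 → Bool :=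
  fun ℓ => decide (∃ i, x i = true ∧ (σ i).val = 4 * j + ℓ.val)

/-- The function that evaluates to `true` on every `x` containing a decoy, that is, a variable in
one of the slots from `4K` on, and otherwise applies `g j` to the labels of `x` in the last
block `j` that it meets. -/
def blockFn {n : ℕ} (K : ℕ) (g : ℕ → (Fin 4 → Bool) → Bool) (σ : Equiv.Perm (Fin n)) :
    BoolFn n :=
  fun x => if K ≤ topBlock σ x then true else g (topBlock σ x) (labels σ x (topBlock σ x))

/-- A decision list on the four labels of a block, read from label `3` down to label `0`, with
values `1, 0, 0, 1`. -/
def listRule (L : Fin 4 → Bool) : Bool := L 3 || (!L 2 && !L 1)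

/-- A function that agrees with `listRule` on singletons, but in which label `3` beats `2`,
`2` beats `0`, `0` beats `1` and `1` beats `3`. -/
def cyclicRule (L : Fin 4 → Bool) : Bool := (L 3 && !L 1) || (!L 2 && (L 0 || !L 1))

/-- Exchange of the labels `0` and `3`, if `b` is `true`. -/
def twist (b : Bool) (L : Fin 4 → Bool) : Fin 4 → Bool :=
  fun ℓ => L (if b then Equiv.swap 0 3 ℓ else ℓ)

/-- The monotone decision list attached to `σ`. -/
def listFn {n : ℕ} (K : ℕ) (σ : Equiv.Perm (Fin n)) : BoolFn n := blockFn K (fun _ => listRule) σ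

/-- The function attached to `σ` that obeys the cyclic rule in each block, after the labels `0`
and `3` are exchanged in the blocks `j` with `η j = true`. -/
def cyclicFn {n : ℕ} (K : ℕ) (η : ℕ → Bool) (σ : Equiv.Perm (Fin n)) : BoolFn n :=
  blockFn K (fun j L => cyclicRule (twist (η j) L)) σ

/-- Four pairs of labels `{3,2}`, `{1,0}`, `{3,1}`, `{2,0}`: the first two and the last two have
the same sum as vectors. -/
def labelPair (t ℓ : Fin 4) : Bool := ![ ![false, false, true, true], ![true, true, false, false],
  ![false, true, false, true], ![true, false, true, false] ] t ℓ

/-- The point whose two variables occupy the slots of block `p.1` with labels in the pair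
`p.2`. -/
def pairPoint {n K : ℕ} (σ : Equiv.Perm (Fin n)) (p : Fin K × Fin 4) : Fin n → Bool :=
  fun i => decide ((σ i).val / 4 = p.1.val) && labelPair p.2 (Fin.ofNat 4 (σ i).val)

/-- The uniform distribution on the `4K` pairs. -/
noncomputable def pairDist {n : ℕ} (K : ℕ) [NeZero K] (σ : Equiv.Perm (Fin n)) :
    PMF (Fin n → Bool) :=
  (PMF.uniformOfFintype (Fin K × Fin 4)).map (pairPoint σ)

theorem listRule_eq_cyclicRule_of_le_labelPair : ∀ (t : Fin 4) (L : Fin 4 → Bool),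
    (∀ ℓ, L ℓ = true → labelPair t ℓ = true) →
      listRule L = cyclicRule (twist (decide (t = 1 ∨ t = 2)) L) := by
  decide

theorem listRule_eq_cyclicRule_of_subsingleton : ∀ (b : Bool) (L : Fin 4 → Bool),
    (∀ ℓ ℓ', L ℓ = true → L ℓ' = true → ℓ = ℓ') → listRule L = cyclicRule (twist b L) := by
  decide

theorem cyclicRule_labelPair : ∀ t : Fin 4, cyclicRule (labelPair t) = decide (t = 0 ∨ t = 1) := by
  decide

theorem exists_labelPair : ∀ t : Fin 4, ∃ ℓ, labelPair t ℓ = true := by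
  decide

theorem labelPair_swap : ∀ t ℓ : Fin 4,
    labelPair t (Equiv.swap 0 3 ℓ) = labelPair (Fin.rev t) ℓ := by
  decide

theorem topBlock_congr {n : ℕ} {σ τ : Equiv.Perm (Fin n)} {x : Fin n → Bool}
    (h : ∀ i, x i = true → (σ i).val / 4 = (τ i).val / 4) : topBlock σ x = topBlock τ x := by
  unfold topBlock
  congr 1
  funext i
  by_cases hx : x i = true
  · simp [hx, h i hx]
  · simp [hx]

theorem labels_congr {n : ℕ} {σ τ : Equiv.Perm (Fin n)} {x : Fin n → Bool}
    (h : ∀ i, x i = true → σ i = τ i) (j : ℕ) : labels σ x j = labels τ x j := by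
  funext ℓ
  unfold labels
  congr 1
  refine propext (exists_congr fun i => and_congr_right fun hx => ?_)
  rw [h i hx]

theorem blockFn_congr {n K : ℕ} {g : ℕ → (Fin 4 → Bool) → Bool} {σ τ : Equiv.Perm (Fin n)}
    {x : Fin n → Bool} (h : ∀ i, x i = true → σ i = τ i) : blockFn K g σ x = blockFn K g τ x := by
  unfold blockFn
  rw [topBlock_congr (τ := τ) (fun i hi => by rw [h i hi]), labels_congr h]

theorem le_topBlock {n : ℕ} (σ : Equiv.Perm (Fin n)) {x : Fin n → Bool} {i : Fin n}
    (hi : x i = true) : (σ i).val / 4 ≤ topBlock σ x := by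
  have := Finset.le_sup (f := fun i => if x i then (σ i).val / 4 else 0) (Finset.mem_univ i)
  simp only [hi, if_true] at this
  exact this

theorem blockFn_of_decoy {n K : ℕ} {g : ℕ → (Fin 4 → Bool) → Bool} {σ : Equiv.Perm (Fin n)}
    {x : Fin n → Bool} {i : Fin n} (hi : x i = true) (hd : 4 * K ≤ (σ i).val) :
    blockFn K g σ x = true := by
  have := le_topBlock σ hi
  unfold blockFn
  rw [if_pos (by omega)]

theorem topBlock_eq {n : ℕ} {σ : Equiv.Perm (Fin n)} {x : Fin n → Bool} {i : Fin n}
    (hi : x i = true) (h : ∀ i', x i' = true → (σ i').val / 4 ≤ (σ i).val / 4) :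
    topBlock σ x = (σ i).val / 4 := by
  refine le_antisymm (Finset.sup_le fun i' _ => ?_) (le_topBlock σ hi)
  by_cases hx : x i' = true
  · simpa [hx] using h i' hx
  · simp [hx]

theorem listFn_mem_monoDL {n : ℕ} (K : ℕ) (σ : Equiv.Perm (Fin n)) : listFn K σ ∈ MonoDL n := by
  refine ⟨Fin.revPerm.trans σ.symm, Fin.snoc (fun j : Fin n =>
    decide (4 * K ≤ j.rev.val ∨ j.rev.val % 4 = 0 ∨ j.rev.val % 4 = 3)) true, fun x => ⟨?_, ?_⟩⟩
  · intro j hj hmin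
    -- every variable of `x` lies in a slot at most that of the first list entry met by `x`
    have hmax : ∀ i, x i = true → (σ i).val ≤ j.rev.val := by
      intro i hi
      by_contra hlt
      push Not at hlt
      have := hmin (σ i).rev (by rw [Fin.lt_def, Fin.val_rev]; rw [Fin.val_rev] at hlt; omega)
      simp [hi] at this
    have hs : σ ((Fin.revPerm.trans σ.symm) j) = j.rev := by simp
    have htop : topBlock σ x = j.rev.val / 4 := by
      rw [topBlock_eq hj (fun i hi => by rw [hs]; exact Nat.div_le_div_right (hmax i hi)), hs]
    have hl : ∀ ℓ : Fin 4, labels σ x (j.rev.val / 4) ℓ = true → ℓ.val ≤ j.rev.val % 4 := by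
      intro ℓ h
      obtain ⟨i, hi, h⟩ := of_decide_eq_true h
      have := hmax i hi
      omega
    have hl' : ∀ ℓ : Fin 4, ℓ.val = j.rev.val % 4 → labels σ x (j.rev.val / 4) ℓ = true := by
      intro ℓ h
      refine decide_eq_true ⟨_, hj, ?_⟩
      rw [hs]
      omega
    rw [Fin.snoc_castSucc]
    unfold listFn blockFn listRule
    rw [htop]
    generalize labels σ x (j.rev.val / 4) = L at hl hl'
    have h4 : j.rev.val % 4 < 4 := Nat.mod_lt _ (by norm_num)
    have e0 := hl' 0; have e1 := hl' 1; have e2 := hl' 2; have e3 := hl' 3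
    have d1 := hl 1; have d2 := hl 2; have d3 := hl 3
    simp only [Fin.isValue, Fin.val_zero, Fin.val_one, Fin.val_two,
      show (3 : Fin 4).val = 3 from rfl] at e0 e1 e2 e3 d1 d2 d3
    by_cases hK : 4 * K ≤ j.rev.val
    · rw [if_pos (by omega)]
      exact (decide_eq_true (Or.inl hK)).symm
    · rw [if_neg (by omega)]
      generalize j.rev.val = s at *
      cases h3 : L 3 <;> cases h2 : L 2 <;> cases h1 : L 1 <;>
        simp only [h1, h2, h3] at * <;> simp [hK] <;> grind
  · intro hx
    have h0 : topBlock σ x = 0 := by simp [topBlock, hx]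
    have hL : labels σ x 0 = fun _ => false := by funext ℓ; simp [labels, hx]
    rw [Fin.snoc_last]
    simp [listFn, blockFn, h0, hL, listRule]

/-! ### Distance from linear threshold functions and from decision lists -/

/-- No function of the class takes the values `1, 1, 0, 0` on points `a, b, c, d` with
`a + b = c + d` as integer vectors. -/
def RespectsSums {n : ℕ} (C : Set (BoolFn n)) : Prop :=
  ∀ g ∈ C, ∀ a b c d : Fin n → Bool,
    (∀ i, (a i).toNat + (b i).toNat = (c i).toNat + (d i).toNat) →
      ¬(g a = true ∧ g b = true ∧ g c = false ∧ g d = false)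

theorem respectsSums_linearThresholdFns (n : ℕ) : RespectsSums (LinearThresholdFns n) := by
  rintro g ⟨w, θ, hg⟩ a b c d hsum ⟨ha, hb, hc, hd⟩
  have ha' := (hg a).1 ha
  have hb' := (hg b).1 hb
  have hc' : ¬ _ := fun h => by simpa [hc] using (hg c).2 h
  have hd' : ¬ _ := fun h => by simpa [hd] using (hg d).2 h
  have key : (∑ i, w i * (if a i then 1 else 0)) + ∑ i, w i * (if b i then 1 else 0) =
      (∑ i, w i * (if c i then 1 else 0)) + ∑ i, w i * (if d i then 1 else 0) := by
    rw [← Finset.sum_add_distrib, ← Finset.sum_add_distrib]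
    refine Finset.sum_congr rfl fun i _ => ?_
    have := hsum i
    cases h1 : a i <;> cases h2 : b i <;> cases h3 : c i <;> cases h4 : d i <;> simp_all
  linarith

theorem respectsSums_monoDL (n : ℕ) : RespectsSums (MonoDL n) := by
  rintro g ⟨π, ν, hg⟩ a b c d hsum ⟨ha, hb, hc, hd⟩
  by_cases hne : ∃ j, a (π j) = true ∨ b (π j) = true
  · -- the first list entry met by `a` or `b` is also the first one met by `c` or `d`
    classical
    obtain ⟨j, hj, hmin⟩ := WellFounded.has_min (wellFounded_lt (α := Fin n))
      {j | a (π j) = true ∨ b (π j) = true} hne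
    have hzero : ∀ i < j, a (π i) = false ∧ b (π i) = false := by
      intro i hi
      have := fun h => hmin i h hi
      simpa using this
    have hzero' : ∀ i < j, c (π i) = false ∧ d (π i) = false := by
      intro i hi
      have h1 := hsum (π i)
      obtain ⟨h2, h3⟩ := hzero i hi
      rw [h2, h3] at h1
      cases h4 : c (π i) <;> cases h5 : d (π i) <;> simp_all
    have hν : ν j.castSucc = true := by
      rcases hj with h | h
      · rw [← ha]; exact ((hg a).1 j h fun i hi => (hzero i hi).1).symm
      · rw [← hb]; exact ((hg b).1 j h fun i hi => (hzero i hi).2).symm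
    have hcd : c (π j) = true ∨ d (π j) = true := by
      have h1 := hsum (π j)
      rcases hj with h | h <;> cases h4 : c (π j) <;> cases h5 : d (π j) <;> simp_all
    rcases hcd with h | h
    · have := (hg c).1 j h fun i hi => (hzero' i hi).1
      simp_all
    · have := (hg d).1 j h fun i hi => (hzero' i hi).2
      simp_all
  · push Not at hne
    have h0 : ∀ i, a i = false ∧ b i = false := fun i => by simpa using hne (π.symm i)
    have h0' : ∀ i, c i = false := fun i => by
      have h1 := hsum i
      rw [(h0 i).1, (h0 i).2] at h1
      cases hc' : c i
      · rfl
      · rw [hc'] at h1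
        simp only [Bool.toNat_false, Bool.toNat_true] at h1
        omega
    have h1 := (hg a).2 fun i => (h0 i).1
    have h2 := (hg c).2 h0'
    simp_all

theorem respectsSums_decisionLists (n : ℕ) : RespectsSums (DecisionLists n) := by
  rintro g ⟨r, hr⟩ a b c d hsum ⟨ha, hb, hc, hd⟩
  refine respectsSums_monoDL n _ hr (fun i => xor (a i) (r i)) (fun i => xor (b i) (r i))
    (fun i => xor (c i) (r i)) (fun i => xor (d i) (r i)) (fun i => ?_) ?_
  · have := hsum i
    cases h1 : a i <;> cases h2 : b i <;> cases h3 : c i <;> cases h4 : d i <;>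
      cases h5 : r i <;> simp_all
  · simpa using ⟨ha, hb, hc, hd⟩

theorem monoDL_subset_decisionLists (n : ℕ) : MonoDL n ⊆ DecisionLists n := by
  intro f hf
  exact ⟨fun _ => false, by simpa using hf⟩

/-- The slot with label `ℓ` in block `j`. -/
def slot {n K : ℕ} (hn : 4 * K ≤ n) (j : Fin K) (ℓ : Fin 4) : Fin n :=
  ⟨4 * j.val + ℓ.val, by omega⟩

theorem pairPoint_eq_true_iff {n K : ℕ} (hn : 4 * K ≤ n) (σ : Equiv.Perm (Fin n))
    (p : Fin K × Fin 4) (i : Fin n) :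
    pairPoint σ p i = true ↔ ∃ ℓ, labelPair p.2 ℓ = true ∧ σ i = slot hn p.1 ℓ := by
  unfold pairPoint slot
  simp only [Bool.and_eq_true, decide_eq_true_eq, Fin.ext_iff]
  constructor
  · rintro ⟨h1, h2⟩
    exact ⟨_, h2, by simp only [Fin.val_ofNat]; omega⟩
  · rintro ⟨ℓ, h1, h2⟩
    refine ⟨by omega, ?_⟩
    rwa [show Fin.ofNat 4 (σ i).val = ℓ from Fin.ext (by simp only [Fin.val_ofNat]; omega)]

theorem block_of_pairPoint {n K : ℕ} {σ : Equiv.Perm (Fin n)} {p : Fin K × Fin 4} {i : Fin n}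
    (hi : pairPoint σ p i = true) : (σ i).val / 4 = p.1.val := by
  unfold pairPoint at hi
  simp only [Bool.and_eq_true, decide_eq_true_eq] at hi
  exact hi.1

theorem labels_pairPoint {n K : ℕ} (hn : 4 * K ≤ n) (σ : Equiv.Perm (Fin n))
    (p : Fin K × Fin 4) : labels σ (pairPoint σ p) p.1.val = labelPair p.2 := by
  funext ℓ
  unfold labels
  rw [Bool.eq_iff_iff, decide_eq_true_iff]
  constructor
  · rintro ⟨i, hi, h⟩
    obtain ⟨ℓ', h1, h2⟩ := (pairPoint_eq_true_iff hn σ p i).1 hi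
    rw [h2] at h
    simp only [slot] at h
    rwa [show ℓ = ℓ' from Fin.ext (by omega)]
  · intro h
    exact ⟨σ.symm (slot hn p.1 ℓ), (pairPoint_eq_true_iff hn σ p _).2 ⟨ℓ, h, by simp⟩,
      by simp [slot]⟩

theorem topBlock_pairPoint {n K : ℕ} (hn : 4 * K ≤ n) (σ : Equiv.Perm (Fin n))
    (p : Fin K × Fin 4) : topBlock σ (pairPoint σ p) = p.1.val := by
  obtain ⟨ℓ, hℓ⟩ := exists_labelPair p.2
  have hi := (pairPoint_eq_true_iff hn σ p (σ.symm (slot hn p.1 ℓ))).2 ⟨ℓ, hℓ, by simp⟩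
  rw [topBlock_eq hi fun i' h => by rw [block_of_pairPoint hi, block_of_pairPoint h],
    block_of_pairPoint hi]

theorem cyclicFn_pairPoint {n K : ℕ} (hn : 4 * K ≤ n) (σ : Equiv.Perm (Fin n))
    (p : Fin K × Fin 4) :
    cyclicFn K (fun _ => false) σ (pairPoint σ p) = decide (p.2 = 0 ∨ p.2 = 1) := by
  unfold cyclicFn blockFn
  rw [topBlock_pairPoint hn, if_neg (by omega), labels_pairPoint hn]
  exact cyclicRule_labelPair p.2

theorem isFar_cyclicFn {n K : ℕ} [NeZero K] (hn : 4 * K ≤ n) (σ : Equiv.Perm (Fin n))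
    {C : Set (BoolFn n)} (hC : RespectsSums C) {ε : ℝ} (hε : ε ≤ 1 / 4) :
    IsFar ε (pairDist K σ) (cyclicFn K (fun _ => false) σ) C := by
  classical
  refine le_iInf₂ fun g hg => ?_
  -- in each block the two functions differ on one of the four pairs
  have hex : ∀ j : Fin K, ∃ t : Fin 4,
      cyclicFn K (fun _ => false) σ (pairPoint σ (j, t)) ≠ g (pairPoint σ (j, t)) := by
    intro j
    by_contra! h
    simp only [cyclicFn_pairPoint hn] at h
    refine hC g hg (pairPoint σ (j, 0)) (pairPoint σ (j, 1)) (pairPoint σ (j, 2))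
      (pairPoint σ (j, 3)) (fun i => ?_)
      ⟨(h 0).symm, (h 1).symm, (h 2).symm, (h 3).symm⟩
    unfold pairPoint
    simp only
    have : ∀ ℓ : Fin 4, (labelPair 0 ℓ).toNat + (labelPair 1 ℓ).toNat =
      (labelPair 2 ℓ).toNat + (labelPair 3 ℓ).toNat := by decide
    cases decide ((σ i).val / 4 = j.val)
    · simp
    · simpa using this _
  choose t ht using hex
  unfold distUnder pairDist
  rw [PMF.toOuterMeasure_map_apply, PMF.toOuterMeasure_uniformOfFintype_apply]
  have hcard : K ≤ Fintype.card ((pairPoint σ ⁻¹'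
      {x | cyclicFn K (fun _ => false) σ x ≠ g x} : Set (Fin K × Fin 4))) := by
    have := Fintype.card_le_of_injective
      (fun j : Fin K => (⟨(j, t j), ht j⟩ :
        (pairPoint σ ⁻¹' {x | cyclicFn K (fun _ => false) σ x ≠ g x} : Set (Fin K × Fin 4))))
      (fun j j' h => congrArg (fun q => q.1.1) h)
    rwa [Fintype.card_fin] at this
  have hK : (K : ENNReal) ≠ 0 := by simpa using NeZero.ne K
  calc ENNReal.ofReal ε ≤ ENNReal.ofReal (1 / 4) := ENNReal.ofReal_le_ofReal hε
    _ = (K : ENNReal) / (Fintype.card (Fin K × Fin 4) : ENNReal) := by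
      rw [Fintype.card_prod, Fintype.card_fin, Fintype.card_fin, Nat.cast_mul,
        ENNReal.ofReal_div_of_pos (by norm_num), ← mul_one (K : ENNReal), mul_assoc,
        ENNReal.mul_div_mul_left _ _ hK (ENNReal.natCast_ne_top K)]
      simp
    _ ≤ _ := by gcongr

/-! ### Sets of permutations that are exchangeable outside the revealed variables -/

/-- The set `A` of permutations puts no constraint on the variables outside `P`, except through
the set of slots left for them. -/
def SwapClosed {n : ℕ} (A : Finset (Equiv.Perm (Fin n))) (P : Finset (Fin n)) : Prop :=
  ∀ σ ∈ A, ∀ u v, u ∉ P → v ∉ P → σ * Equiv.swap u v ∈ A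

theorem mul_swap_apply_of_mem {n : ℕ} {P : Finset (Fin n)} (σ : Equiv.Perm (Fin n))
    {u v i : Fin n} (hu : u ∉ P) (hv : v ∉ P) (hi : i ∈ P) : (σ * Equiv.swap u v) i = σ i := by
  rw [Equiv.Perm.mul_apply, Equiv.swap_apply_of_ne_of_ne]
  · rintro rfl; exact hu hi
  · rintro rfl; exact hv hi

theorem SwapClosed.filter {n : ℕ} {A : Finset (Equiv.Perm (Fin n))} {P Q : Finset (Fin n)}
    (hA : SwapClosed A P) (hPQ : P ⊆ Q) (q : Equiv.Perm (Fin n) → Prop) [DecidablePred q]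
    (hq : ∀ σ u v, u ∉ Q → v ∉ Q → q σ → q (σ * Equiv.swap u v)) :
    SwapClosed (A.filter q) Q := by
  intro σ hσ u v hu hv
  rw [Finset.mem_filter] at hσ ⊢
  exact ⟨hA σ hσ.1 u v (fun h => hu (hPQ h)) (fun h => hv (hPQ h)), hq σ u v hu hv hσ.2⟩

theorem SwapClosed.filter_of_congr {n : ℕ} {A : Finset (Equiv.Perm (Fin n))}
    {P Q : Finset (Fin n)} (hA : SwapClosed A P) (hPQ : P ⊆ Q) (q : Equiv.Perm (Fin n) → Prop)
    [DecidablePred q] (hq : ∀ σ τ : Equiv.Perm (Fin n), (∀ i ∈ Q, σ i = τ i) → q σ → q τ) :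
    SwapClosed (A.filter q) Q :=
  hA.filter hPQ q fun σ _ _ hu hv =>
    hq σ _ fun _ hi => (mul_swap_apply_of_mem σ hu hv hi).symm

/-- The variables outside `P` are equally likely to have a property that depends only on their slot
and on the slots of `P`. -/
theorem SwapClosed.sum_card {n : ℕ} {A : Finset (Equiv.Perm (Fin n))} {P : Finset (Fin n)}
    (hA : SwapClosed A P) (q : Equiv.Perm (Fin n) → Fin n → Prop) [∀ σ, DecidablePred (q σ)]
    (hq : ∀ σ u v, u ∉ P → v ∉ P → q σ u → q (σ * Equiv.swap u v) v) {x : Fin n} (hx : x ∉ P) :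
    ∑ σ ∈ A, (Pᶜ.filter (q σ)).card = Pᶜ.card * (A.filter fun σ => q σ x).card := by
  have h1 : ∀ u v, u ∉ P → v ∉ P →
      (A.filter fun σ => q σ u).card ≤ (A.filter fun σ => q σ v).card := by
    intro u v hu hv
    refine Finset.card_le_card_of_injOn (fun σ => σ * Equiv.swap u v) (fun σ hσ => ?_)
      (fun σ _ τ _ h => mul_right_cancel h)
    simp only [Finset.coe_filter, Set.mem_ofPred_eq] at hσ ⊢
    exact ⟨hA σ hσ.1 u v hu hv, hq σ u v hu hv hσ.2⟩
  simp only [Finset.card_filter]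
  rw [Finset.sum_comm, ← smul_eq_mul, ← Finset.sum_const]
  refine Finset.sum_congr rfl fun u hu => ?_
  have hu' := Finset.mem_compl.1 hu
  simp only [← Finset.card_filter]
  exact le_antisymm (h1 u x hu' hx) (h1 x u hx hu')

theorem card_block_le {n : ℕ} (σ : Equiv.Perm (Fin n)) (m : ℕ) :
    (Finset.univ.filter fun u => (σ u).val / 4 = m).card ≤ 4 := by
  have := Finset.card_le_card_of_injOn (s := Finset.univ.filter fun u => (σ u).val / 4 = m)
    (t := Finset.Ico (4 * m) (4 * m + 4)) (fun u => (σ u).val)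
    (fun u hu => by
      simp only [Finset.coe_filter, Finset.mem_univ, true_and, Set.mem_ofPred_eq,
        Finset.coe_Ico, Set.mem_Ico] at hu ⊢
      omega)
    (fun u _ v _ h => σ.injective (Fin.ext h))
  simpa using this

theorem SwapClosed.card_collision_le {n : ℕ} {A : Finset (Equiv.Perm (Fin n))}
    {P : Finset (Fin n)} (hA : SwapClosed A P) {x : Fin n} (hx : x ∉ P) :
    Pᶜ.card * (A.filter fun σ => ∃ i ∈ P, (σ i).val / 4 = (σ x).val / 4).card ≤
      A.card * (P.card * 4) := by
  rw [← hA.sum_card (fun σ x => ∃ i ∈ P, (σ i).val / 4 = (σ x).val / 4) _ hx]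
  · rw [← smul_eq_mul A.card, ← Finset.sum_const]
    refine Finset.sum_le_sum fun σ _ => ?_
    calc (Pᶜ.filter fun x => ∃ i ∈ P, (σ i).val / 4 = (σ x).val / 4).card
        ≤ (P.biUnion fun i => Finset.univ.filter fun u =>
            (σ u).val / 4 = (σ i).val / 4).card := by
          refine Finset.card_le_card fun u hu => ?_
          obtain ⟨-, i, hi, h⟩ := Finset.mem_filter.1 hu
          exact Finset.mem_biUnion.2 ⟨i, hi, by simp [h]⟩
      _ ≤ P.card * 4 := Finset.card_biUnion_le_card_mul _ _ _ fun i _ => card_block_le σ _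
  · rintro σ u v hu hv ⟨i, hi, h⟩
    refine ⟨i, hi, ?_⟩
    rw [mul_swap_apply_of_mem σ hu hv hi, h]
    simp

theorem SwapClosed.le_card_decoy {n K : ℕ} {A : Finset (Equiv.Perm (Fin n))}
    {P : Finset (Fin n)} (hA : SwapClosed A P) {x : Fin n} (hx : x ∉ P) :
    A.card * (n - 4 * K - P.card) ≤ Pᶜ.card * (A.filter fun σ => 4 * K ≤ (σ x).val).card := by
  rw [← hA.sum_card (fun σ x => 4 * K ≤ (σ x).val) (fun σ u v _ _ h => by simpa using h) hx,
    ← smul_eq_mul A.card, ← Finset.sum_const]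
  refine Finset.sum_le_sum fun σ _ => ?_
  have h1 : (Finset.univ.filter fun u => ¬ 4 * K ≤ (σ u).val).card ≤ 4 * K := by
    have := Finset.card_le_card_of_injOn
      (s := Finset.univ.filter fun u => ¬ 4 * K ≤ (σ u).val)
      (t := Finset.range (4 * K)) (fun u => (σ u).val)
      (fun u hu => by simpa using hu) (fun u _ v _ h => σ.injective (Fin.ext h))
    simpa using this
  have h2 := Finset.card_filter_add_card_filter_not (s := (Finset.univ : Finset (Fin n)))
    (fun u => 4 * K ≤ (σ u).val)
  have h3 : (Finset.univ.filter fun u => 4 * K ≤ (σ u).val).card ≤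
      (Pᶜ.filter fun u => 4 * K ≤ (σ u).val).card + P.card := by
    refine (Finset.card_le_card fun u hu => ?_).trans (Finset.card_union_le _ _)
    by_cases h : u ∈ P <;> simp_all
  rw [Finset.card_univ, Fintype.card_fin] at h2
  omega

/-! ### Exchanging two slots of a block -/

theorem twist_twist (a b : Bool) (L : Fin 4 → Bool) : twist a (twist b L) = twist (xor a b) L := by
  funext ℓ
  unfold twist
  cases a <;> cases b <;> simp

/-- The permutation of the slots that exchanges the labels `0` and `3` of block `j`. -/
def slotSwap {n K : ℕ} (hn : 4 * K ≤ n) (j : Fin K) : Equiv.Perm (Fin n) :=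
  Equiv.swap (slot hn j 0) (slot hn j 3)

theorem slotSwap_val {n K : ℕ} (hn : 4 * K ≤ n) (j : Fin K) (s : Fin n) :
    (slotSwap hn j s).val = if s.val / 4 = j.val then
      4 * j.val + (Equiv.swap (0 : Fin 4) 3 (Fin.ofNat 4 s.val)).val else s.val := by
  unfold slotSwap
  by_cases h : s.val / 4 = j.val
  · obtain ⟨ℓ, hℓ⟩ : ∃ ℓ : Fin 4, s = slot hn j ℓ :=
      ⟨Fin.ofNat 4 s.val, Fin.ext (by simp only [slot, Fin.val_ofNat]; omega)⟩
    have hof : Fin.ofNat 4 s.val = ℓ := by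
      rw [hℓ]; exact Fin.ext (by simp only [slot, Fin.val_ofNat]; omega)
    have hinj : Function.Injective (slot hn j) := fun a b h => Fin.ext (by
      have := congrArg Fin.val h
      simp only [slot] at this
      omega)
    rw [if_pos h, hof, hℓ, ← hinj.map_swap]
    rfl
  · rw [if_neg h, Equiv.swap_apply_of_ne_of_ne]
    · rintro rfl
      exact h (by simp only [slot, Fin.val_zero]; omega)
    · rintro rfl
      exact h (by simp only [slot, show (3 : Fin 4).val = 3 from rfl]; omega)

theorem slotSwap_div {n K : ℕ} (hn : 4 * K ≤ n) (j : Fin K) (s : Fin n) :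
    (slotSwap hn j s).val / 4 = s.val / 4 := by
  rw [slotSwap_val]
  split_ifs <;> omega

theorem labels_slotSwap_mul {n K : ℕ} (hn : 4 * K ≤ n) (j : Fin K) (σ : Equiv.Perm (Fin n))
    (x : Fin n → Bool) (j' : ℕ) :
    labels (slotSwap hn j * σ) x j' = twist (decide (j' = j.val)) (labels σ x j') := by
  funext ℓ
  unfold labels twist
  congr 1
  refine propext (exists_congr fun i => and_congr_right fun _ => ?_)
  rw [Equiv.Perm.mul_apply, slotSwap_val]
  have key : ∀ a b : Fin 4, (Equiv.swap (0 : Fin 4) 3 a = b ↔ a = Equiv.swap (0 : Fin 4) 3 b) := by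
    decide
  have := key (Fin.ofNat 4 (σ i).val) ℓ
  simp only [Fin.ext_iff, Fin.val_ofNat] at this
  by_cases hj : j' = j.val
  · subst hj
    simp only [decide_true, if_true]
    split_ifs with h
    · omega
    · omega
  · simp only [hj, decide_false, Bool.false_eq_true, if_false]
    split_ifs with h
    · constructor <;> intro h' <;> omega
    · rfl

theorem cyclicFn_slotSwap_mul {n K : ℕ} (hn : 4 * K ≤ n) (j : Fin K) (η : ℕ → Bool)
    (σ : Equiv.Perm (Fin n)) :
    cyclicFn K η (slotSwap hn j * σ) = cyclicFn K (fun j' => xor (η j') (decide (j' = j.val))) σ := by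
  funext x
  unfold cyclicFn blockFn
  have : topBlock (slotSwap hn j * σ) x = topBlock σ x :=
    topBlock_congr fun i _ => slotSwap_div hn j (σ i)
  rw [this, labels_slotSwap_mul]
  simp only [twist_twist]

theorem pairPoint_slotSwap_mul {n K : ℕ} (hn : 4 * K ≤ n) (j : Fin K) (σ : Equiv.Perm (Fin n))
    (p : Fin K × Fin 4) : pairPoint (slotSwap hn j * σ) p =
      pairPoint σ (p.1, if p.1 = j then p.2.rev else p.2) := by
  funext i
  unfold pairPoint
  rw [Equiv.Perm.mul_apply, slotSwap_div, slotSwap_val]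
  by_cases h : (σ i).val / 4 = p.1.val
  · by_cases hj : p.1 = j
    · rw [if_pos hj, if_pos (by rw [h, hj]), ← labelPair_swap]
      congr 2
      exact Fin.ext (by simp only [Fin.val_ofNat]; omega)
    · rw [if_neg hj, if_neg (by rw [h]; exact fun h' => hj (Fin.ext h'))]
  · simp [h]

theorem pairDist_slotSwap_mul {n K : ℕ} [NeZero K] (hn : 4 * K ≤ n) (j : Fin K)
    (σ : Equiv.Perm (Fin n)) : pairDist K (slotSwap hn j * σ) = pairDist K σ := by
  let e : Fin K × Fin 4 ≃ Fin K × Fin 4 :=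
    Function.Involutive.toPerm (fun p => (p.1, if p.1 = j then p.2.rev else p.2)) (by
      rintro ⟨a, b⟩
      by_cases h : a = j <;> simp [h])
  have he : pairPoint (slotSwap hn j * σ) = pairPoint σ ∘ e :=
    funext fun p => pairPoint_slotSwap_mul hn j σ p
  unfold pairDist
  rw [he, ← PMF.map_comp]
  congr 1
  ext p
  rw [PMF.map_apply, tsum_eq_single (e.symm p)]
  · simp
  · intro b hb
    rw [if_neg]
    rintro rfl
    simp at hb

/-! ### The two functions are indistinguishable -/

/-- The probability that the deterministic algorithm `T` accepts. -/
noncomputable def acceptProb {n : ℕ} (f : BoolFn n) (D : PMF (Fin n → Bool)) (T : DetAlg n) : ℝ :=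
  (T.run f D true).toReal

theorem acceptProb_nonneg {n : ℕ} (f : BoolFn n) (D : PMF (Fin n → Bool)) (T : DetAlg n) :
    0 ≤ acceptProb f D T := ENNReal.toReal_nonneg

theorem acceptProb_le_one {n : ℕ} (f : BoolFn n) (D : PMF (Fin n → Bool)) (T : DetAlg n) :
    acceptProb f D T ≤ 1 :=
  ENNReal.toReal_le_of_le_ofReal zero_le_one (by simpa using PMF.coe_le_one _ _)

theorem acceptProb_query {n : ℕ} (f : BoolFn n) (D : PMF (Fin n → Bool)) (q : Fin n → Bool)
    (next : Bool → DetAlg n) :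
    acceptProb f D (.query q next) = acceptProb f D (next (f q)) := rfl

theorem acceptProb_sample {n K : ℕ} [NeZero K] (f : BoolFn n) (σ : Equiv.Perm (Fin n))
    (next : (Fin n → Bool) → DetAlg n) :
    acceptProb f (pairDist K σ) (.sample next) =
      (∑ j : Fin K, ∑ t : Fin 4, acceptProb f (pairDist K σ) (next (pairPoint σ (j, t)))) /
        (4 * K) := by
  unfold acceptProb
  have h1 : DetAlg.run f (pairDist K σ) (.sample next) =
      (PMF.uniformOfFintype (Fin K × Fin 4)).bind fun p =>
        DetAlg.run f (pairDist K σ) (next (pairPoint σ p)) := by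
    change (pairDist K σ).bind _ = _
    conv_lhs => rw [pairDist]
    rw [PMF.bind_map]
    rfl
  rw [h1, PMF.bind_apply, tsum_fintype, ENNReal.toReal_sum]
  · rw [← Fintype.sum_prod_type'
      (f := fun j t => (DetAlg.run f (pairDist K σ) (next (pairPoint σ (j, t))) true).toReal),
      Finset.sum_div]
    refine Finset.sum_congr rfl fun p _ => ?_
    rw [ENNReal.toReal_mul, PMF.uniformOfFintype_apply, ENNReal.toReal_inv]
    simp only [Fintype.card_prod, Fintype.card_fin, Nat.cast_mul, ENNReal.toReal_mul,
      ENNReal.toReal_natCast, Nat.cast_ofNat, ENNReal.toReal_ofNat]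
    ring
  · exact fun p _ => ENNReal.mul_ne_top (PMF.apply_ne_top _ _) (PMF.apply_ne_top _ _)

/-- As long as all variables of the points seen lie in `P`, the list function and the cyclic
function twisted by `η` look the same; `η` is still `false` on the blocks that `P` does not meet. -/
structure Hidden {n : ℕ} (K : ℕ) (σ : Equiv.Perm (Fin n)) (P : Finset (Fin n)) (η : ℕ → Bool) :
    Prop where
  agree : ∀ j < K, ∀ x : Fin n → Bool, (∀ i, x i = true → i ∈ P) →
    listRule (labels σ x j) = cyclicRule (twist (η j) (labels σ x j))
  fresh : ∀ j, (∀ i ∈ P, (σ i).val / 4 ≠ j) → η j = false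

theorem Hidden.listFn_eq {n K : ℕ} {σ : Equiv.Perm (Fin n)} {P : Finset (Fin n)} {η : ℕ → Bool}
    (h : Hidden K σ P η) {x : Fin n → Bool} (hx : ∀ i, x i = true → i ∈ P) :
    listFn K σ x = cyclicFn K η σ x := by
  unfold listFn cyclicFn blockFn
  split_ifs with hK
  · rfl
  · exact h.agree _ (by omega) x hx

/-- Only the variables in block `j` matter for the labels in block `j`. -/
theorem labels_eq_of_block {n : ℕ} {σ : Equiv.Perm (Fin n)} {x y : Fin n → Bool} {j : ℕ}
    (h : ∀ i, (σ i).val / 4 = j → x i = y i) : labels σ x j = labels σ y j := by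
  funext ℓ
  unfold labels
  congr 1
  refine propext (exists_congr fun i => and_congr_left fun hi => ?_)
  rw [h i (by omega)]

theorem Hidden.agree_of_block {n K : ℕ} {σ : Equiv.Perm (Fin n)} {P : Finset (Fin n)}
    {η : ℕ → Bool} (h : Hidden K σ P η) {j : ℕ} (hj : j < K) {x : Fin n → Bool}
    (hx : ∀ i, (σ i).val / 4 = j → x i = true → i ∈ P) :
    listRule (labels σ x j) = cyclicRule (twist (η j) (labels σ x j)) := by
  have := h.agree j hj (fun i => x i && decide (i ∈ P)) (fun i hi => by simp at hi; exact hi.2)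
  rwa [labels_eq_of_block (y := x)] at this
  intro i hi
  have := hx i hi
  cases hxi : x i <;> simp_all

/-- Revealing a decoy, or a variable whose block is not met by `P`, keeps the functions
indistinguishable. -/
theorem Hidden.insert {n K : ℕ} {σ : Equiv.Perm (Fin n)} {P : Finset (Fin n)} {η : ℕ → Bool}
    (h : Hidden K σ P η) {u : Fin n}
    (hu : 4 * K ≤ (σ u).val ∨ ∀ i ∈ P, (σ i).val / 4 ≠ (σ u).val / 4) :
    Hidden K σ (insert u P) η := by
  refine ⟨fun j hj x hx => ?_, fun j hj => h.fresh j fun i hi => hj i (Finset.mem_insert_of_mem hi)⟩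
  by_cases huj : (σ u).val / 4 = j
  · have hu' := hu.resolve_left (by omega)
    refine listRule_eq_cyclicRule_of_subsingleton _ _ fun ℓ ℓ' hℓ hℓ' => ?_
    have key : ∀ ℓ : Fin 4, labels σ x j ℓ = true → (σ u).val = 4 * j + ℓ.val := by
      intro ℓ hℓ
      obtain ⟨i, hi, hs⟩ := of_decide_eq_true hℓ
      rcases Finset.mem_insert.1 (hx i hi) with rfl | hiP
      · exact hs
      · exact absurd (by omega) (hu' i hiP)
    have := key ℓ hℓ
    have := key ℓ' hℓ'
    exact Fin.ext (by omega)
  · refine h.agree_of_block hj fun i hi hxi => ?_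
    rcases Finset.mem_insert.1 (hx i hxi) with rfl | hiP
    · exact absurd hi huj
    · exact hiP

/-- The support of a point. -/
def onesOf {n : ℕ} (x : Fin n → Bool) : Finset (Fin n) := Finset.univ.filter fun i => x i = true

theorem mem_onesOf {n : ℕ} {x : Fin n → Bool} {i : Fin n} : i ∈ onesOf x ↔ x i = true := by
  simp [onesOf]

/-- The twist after a sample of pair `t` from block `j`. The pairs `1` and `2` are the ones on which
the list and the cyclic function differ, and the exchange of the labels `0` and `3` turns one into
the other. -/
def retwist (η : ℕ → Bool) (j : ℕ) (t : Fin 4) : ℕ → Bool :=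
  fun j' => xor (η j') (decide (j' = j) && decide (t = 1 ∨ t = 2))

/-- Revealing a sampled pair of a block not met by `P` keeps the functions indistinguishable, with
the twist adjusted. -/
theorem Hidden.union_pairPoint {n K : ℕ} (hn : 4 * K ≤ n) {σ : Equiv.Perm (Fin n)}
    {P : Finset (Fin n)} {η : ℕ → Bool} (h : Hidden K σ P η) {j : Fin K} (t : Fin 4)
    (hj : ∀ i ∈ P, (σ i).val / 4 ≠ j.val) :
    Hidden K σ (P ∪ onesOf (pairPoint σ (j, t))) (retwist η j t) := by
  refine ⟨fun j' hj' x hx => ?_, fun j' hj' => ?_⟩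
  · unfold retwist
    by_cases e : j' = j.val
    · subst e
      rw [h.fresh _ hj]
      simp only [decide_true, Bool.true_and, Bool.false_xor]
      refine listRule_eq_cyclicRule_of_le_labelPair t _ fun ℓ hℓ => ?_
      rw [← labels_pairPoint hn σ (j, t)]
      obtain ⟨i, hi, hs⟩ := of_decide_eq_true hℓ
      refine decide_eq_true ⟨i, ?_, hs⟩
      rcases Finset.mem_union.1 (hx i hi) with hP | hp
      · exact absurd (by omega) (hj i hP)
      · exact mem_onesOf.1 hp
    · simp only [e, decide_false, Bool.false_and, Bool.xor_false]
      refine h.agree_of_block hj' fun i hi hxi => ?_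
      rcases Finset.mem_union.1 (hx i hxi) with hP | hp
      · exact hP
      · exact absurd (hi.symm.trans (block_of_pairPoint (mem_onesOf.1 hp))) e
  · have e : j' ≠ j.val := by
      rintro rfl
      obtain ⟨ℓ, hℓ⟩ := exists_labelPair t
      have hi := (pairPoint_eq_true_iff hn σ (j, t) (σ.symm (slot hn j ℓ))).2 ⟨ℓ, hℓ, by simp⟩
      exact hj' _ (Finset.mem_union_right _ (mem_onesOf.2 hi)) (block_of_pairPoint hi)
    unfold retwist
    simp only [e, decide_false, Bool.false_and, Bool.xor_false]
    exact h.fresh j' fun i hi => hj' i (Finset.mem_union_left _ hi)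

theorem card_onesOf_pairPoint_le {n K : ℕ} (hn : 4 * K ≤ n) (σ : Equiv.Perm (Fin n))
    (p : Fin K × Fin 4) : (onesOf (pairPoint σ p)).card ≤ 2 := by
  have h2 : ∀ t : Fin 4, (Finset.univ.filter fun ℓ => labelPair t ℓ = true).card ≤ 2 := by decide
  refine le_trans ?_ (h2 p.2)
  refine (Finset.card_le_card (t := (Finset.univ.filter fun ℓ => labelPair p.2 ℓ = true).image
    fun ℓ => σ.symm (slot hn p.1 ℓ)) fun i hi => ?_).trans Finset.card_image_le
  obtain ⟨ℓ, hℓ, hs⟩ := (pairPoint_eq_true_iff hn σ p i).1 (mem_onesOf.1 hi)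
  exact Finset.mem_image.2 ⟨ℓ, by simpa using hℓ, by rw [← hs]; simp⟩

/-- Started with the variables of a set `P` revealed, an algorithm `T` of cost at most `r`
distinguishes the two functions with advantage at most `(|P| + 6r) / s`. The permutation is uniform
on a set `A` that reflects the revealed information only. -/
def Indistinguishable {n : ℕ} (K : ℕ) [NeZero K] (s : ℝ) (T : DetAlg n) (r : ℕ) : Prop :=
  ∀ (A : Finset (Equiv.Perm (Fin n))) (P : Finset (Fin n)) (η : ℕ → Bool), SwapClosed A P →
    (∀ σ ∈ A, Hidden K σ P η) → (∀ σ ∈ A, T.maxCost 1 1 (listFn K σ) ≤ r) →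
    ∑ σ ∈ A, (acceptProb (listFn K σ) (pairDist K σ) T -
      acceptProb (cyclicFn K η σ) (pairDist K σ) T) ≤ A.card * ((P.card + 6 * r) / s)

theorem sum_acceptProb_sub_le_card {n K : ℕ} [NeZero K] (A : Finset (Equiv.Perm (Fin n)))
    (η : ℕ → Bool) (T : Equiv.Perm (Fin n) → DetAlg n) :
    ∑ σ ∈ A, (acceptProb (listFn K σ) (pairDist K σ) (T σ) -
      acceptProb (cyclicFn K η σ) (pairDist K σ) (T σ)) ≤ A.card := by
  rw [← nsmul_one, ← Finset.sum_const]
  refine Finset.sum_le_sum fun σ _ => ?_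
  have := acceptProb_nonneg (cyclicFn K η σ) (pairDist K σ) (T σ)
  have := acceptProb_le_one (listFn K σ) (pairDist K σ) (T σ)
  linarith

/-- The trivial bound suffices once `s` variables are revealed. -/
theorem card_le_card_mul_div {A P : ℕ} {a s : ℝ} (hs : 0 < s) (h : s ≤ P) (ha : 0 ≤ a) :
    (A : ℝ) ≤ A * ((P + a) / s) := by
  have : 1 ≤ (P + a) / s := by rw [le_div_iff₀ hs]; linarith
  nlinarith [Nat.cast_nonneg (α := ℝ) A]

theorem cast_card_compl {n : ℕ} (P : Finset (Fin n)) : (Pᶜ.card : ℝ) = n - P.card := by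
  rw [Finset.card_compl, Fintype.card_fin, Nat.cast_sub]
  simpa using Finset.card_le_univ P

/-- While fewer than `s` variables are revealed, a new one falls into a block met before with
probability at most `1 / s`. -/
theorem SwapClosed.card_collision_mul_le {n : ℕ} {A : Finset (Equiv.Perm (Fin n))}
    {P : Finset (Fin n)} (hA : SwapClosed A P) {s : ℝ} (hs : 0 < s)
    (hcol : 4 * s ^ 2 ≤ n - s) (hP : P.card < s) {u : Fin n} (hu : u ∉ P) :
    ((A.filter fun σ => ∃ i ∈ P, (σ i).val / 4 = (σ u).val / 4).card : ℝ) * s ≤ A.card := by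
  have h2 : (Pᶜ.card : ℝ) * (A.filter fun σ => ∃ i ∈ P, (σ i).val / 4 = (σ u).val / 4).card ≤
      A.card * (P.card * 4) := by
    exact_mod_cast hA.card_collision_le hu
  rw [cast_card_compl] at h2
  have hp0 : (0 : ℝ) ≤ P.card := Nat.cast_nonneg _
  have hnP : (0 : ℝ) < n - P.card := by nlinarith
  generalize ((A.filter fun σ => ∃ i ∈ P, (σ i).val / 4 = (σ u).val / 4).card : ℝ) = c at *
  refine le_of_mul_le_mul_left ?_ hnP
  calc ((n : ℝ) - P.card) * (c * s) = ((n - P.card) * c) * s := by ring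
    _ ≤ (A.card * (P.card * 4)) * s := by gcongr
    _ = A.card * (4 * (P.card * s)) := by ring
    _ ≤ A.card * (n - P.card) := by gcongr; nlinarith
    _ = (n - P.card) * A.card := by ring

/-- While few variables are revealed, a new one is a decoy with probability at least `1 / 3`. -/
theorem SwapClosed.card_le_three_mul_card_decoy {n K : ℕ} {A : Finset (Equiv.Perm (Fin n))}
    {P : Finset (Fin n)} (hA : SwapClosed A P) {s : ℝ} (h8 : 8 * K ≤ n) (hs : 0 < s)
    (hdec : 4 * s ≤ n) (hP : P.card < s) {u : Fin n} (hu : u ∉ P) :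
    (A.card : ℝ) ≤ 3 * (A.filter fun σ => 4 * K ≤ (σ u).val).card := by
  have h2 : (A.card * (n - 4 * K - P.card : ℕ) : ℝ) ≤
      Pᶜ.card * (A.filter fun σ => 4 * K ≤ (σ u).val).card := by
    exact_mod_cast hA.le_card_decoy (K := K) hu
  rw [cast_card_compl] at h2
  have h8' : (8 : ℝ) * K ≤ n := by exact_mod_cast h8
  have hA0 : (0 : ℝ) ≤ A.card := Nat.cast_nonneg _
  have h3 : (n : ℝ) ≤ ((n - 4 * K - P.card : ℕ) : ℝ) + (4 * K + P.card) := by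
    exact_mod_cast (by omega : n ≤ (n - 4 * K - P.card) + (4 * K + P.card))
  have hnP : (0 : ℝ) < n - P.card := by linarith
  refine le_of_mul_le_mul_left ?_ hnP
  calc ((n : ℝ) - P.card) * A.card = A.card * (n - P.card) := by ring
    _ ≤ A.card * (3 * (n - 4 * K - P.card : ℕ)) := by gcongr; linarith
    _ = 3 * (A.card * (n - 4 * K - P.card : ℕ)) := by ring
    _ ≤ 3 * ((n - P.card) * (A.filter fun σ => 4 * K ≤ (σ u).val).card) := by gcongr
    _ = _ := by ring

/-- Revealing a variable: with `a` permutations in all, `d` make it a decoy, `c` put it into a block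
met before, and `m` into a new block. A decoy ends the query; its gain of `6 / s` pays for the
collisions and for the expected number of further variables. -/
theorem query_step_bound {a d c m p r s : ℝ} (hs : 0 < s) (hp : 0 ≤ p) (hr : 0 ≤ r) (hc : 0 ≤ c)
    (ha : a = d + (c + m)) (hcs : c * s ≤ a) (hd : a ≤ 3 * d) :
    d * ((p + 1 + 6 * r) / s) + (c + m * ((p + 1 + (6 * r + 6)) / s)) ≤
      a * ((p + (6 * r + 6)) / s) := by
  have e : d * ((p + 1 + 6 * r) / s) + (c + m * ((p + 1 + (6 * r + 6)) / s)) =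
      (d * (p + 1 + 6 * r) + (c * s + m * (p + 1 + (6 * r + 6)))) / s := by
    field_simp
  rw [e, ← mul_div_assoc]
  refine div_le_div_of_nonneg_right ?_ hs.le
  have h0 : 0 ≤ c * (p + (6 * r + 6)) := by positivity
  have : a * (p + (6 * r + 6)) = d * (p + (6 * r + 6)) + (c * (p + (6 * r + 6)) +
    m * (p + (6 * r + 6))) := by rw [ha]; ring
  linarith

/-- One more query costs `6 / s`: on average it reveals at most three variables, and each of them
leads to a collision with probability at most `1 / s`. -/
theorem Indistinguishable.query {n K : ℕ} [NeZero K] {s : ℝ} (h8 : 8 * K ≤ n) (hs : 0 < s)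
    (hcol : 4 * s ^ 2 ≤ n - s) (hdec : 4 * s ≤ n) {x : Fin n → Bool} {next : Bool → DetAlg n}
    {r : ℕ} (ih : ∀ b, Indistinguishable K s (next b) r) :
    Indistinguishable K s (.query x next) (r + 1) := by
  -- the variables of the query are revealed one by one, until a decoy shows up
  suffices H : ∀ (k : ℕ) (A : Finset (Equiv.Perm (Fin n))) (P : Finset (Fin n)) (η : ℕ → Bool),
      (onesOf x \ P).card = k → SwapClosed A P → (∀ σ ∈ A, Hidden K σ P η) →
      (∀ σ ∈ A, (DetAlg.query x next).maxCost 1 1 (listFn K σ) ≤ r + 1) →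
      ∑ σ ∈ A, (acceptProb (listFn K σ) (pairDist K σ) (.query x next) -
        acceptProb (cyclicFn K η σ) (pairDist K σ) (.query x next)) ≤
        A.card * ((P.card + (6 * r + 6)) / s) by
    intro A P η hA hH hc
    refine (H _ A P η rfl hA hH hc).trans (le_of_eq ?_)
    push_cast
    ring
  have hcost : ∀ σ, (DetAlg.query x next).maxCost 1 1 (listFn K σ) ≤ r + 1 →
      (next (listFn K σ x)).maxCost 1 1 (listFn K σ) ≤ r := by
    intro σ h
    rw [DetAlg.maxCost] at h
    omega
  intro k
  induction k with
  | zero =>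
    intro A P η hk hA hH hc
    have hxP : ∀ i, x i = true → i ∈ P := fun i hi => by
      by_contra hP
      have := Finset.card_eq_zero.1 hk
      exact Finset.notMem_empty i (this ▸ Finset.mem_sdiff.2 ⟨mem_onesOf.2 hi, hP⟩)
    rw [← Finset.sum_fiberwise A (fun σ => listFn K σ x)]
    have hb : ∀ b : Bool, ∑ σ ∈ A with listFn K σ x = b,
        (acceptProb (listFn K σ) (pairDist K σ) (.query x next) -
          acceptProb (cyclicFn K η σ) (pairDist K σ) (.query x next)) ≤
        (A.filter fun σ => listFn K σ x = b).card * ((P.card + (6 * r + 6)) / s) := by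
      intro b
      have := ih b (A.filter fun σ => listFn K σ x = b) P η
        (hA.filter_of_congr subset_rfl _ fun σ τ h hσ => by
          rw [← hσ]
          exact (blockFn_congr fun i hi => h i (hxP i hi)).symm)
        (fun σ hσ => hH σ (Finset.mem_filter.1 hσ).1)
        (fun σ hσ => by
          obtain ⟨h1, h2⟩ := Finset.mem_filter.1 hσ
          have := hcost σ (hc σ h1)
          rwa [h2] at this)
      refine le_trans (le_of_eq (Finset.sum_congr rfl fun σ hσ => ?_)) (this.trans ?_)
      · obtain ⟨h1, h2⟩ := Finset.mem_filter.1 hσ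
        rw [acceptProb_query, acceptProb_query, ← (hH σ h1).listFn_eq hxP, h2]
      · gcongr
        linarith
    refine (Finset.sum_le_sum fun b _ => hb b).trans (le_of_eq ?_)
    rw [← Finset.sum_mul, ← Nat.cast_sum, ← Finset.card_eq_sum_card_fiberwise (fun _ _ => by simp)]
  | succ k ihk =>
    intro A P η hk hA hH hc
    rcases le_or_gt s P.card with hP | hP
    · exact (sum_acceptProb_sub_le_card A η _).trans
        (card_le_card_mul_div hs hP (by positivity))
    obtain ⟨u, hu⟩ : (onesOf x \ P).Nonempty := by
      rw [← Finset.card_pos]; omega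
    obtain ⟨hux, huP⟩ := Finset.mem_sdiff.1 hu
    have hPu : P ⊆ insert u P := Finset.subset_insert u P
    have hcard : (insert u P).card = P.card + 1 := Finset.card_insert_of_notMem huP
    set B := A.filter fun σ => ¬ 4 * K ≤ (σ u).val with hB
    set Ad := A.filter fun σ => 4 * K ≤ (σ u).val with hAd
    set Ac := B.filter fun σ => ∃ i ∈ P, (σ i).val / 4 = (σ u).val / 4 with hAc
    set An := B.filter fun σ => ¬ ∃ i ∈ P, (σ i).val / 4 = (σ u).val / 4 with hAn
    have hAdA : ∀ σ ∈ Ad, σ ∈ A := fun σ hσ => (Finset.mem_filter.1 hσ).1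
    have hBA : ∀ σ ∈ B, σ ∈ A := fun σ hσ => (Finset.mem_filter.1 hσ).1
    have hAnA : ∀ σ ∈ An, σ ∈ A := fun σ hσ => hBA σ (Finset.mem_filter.1 hσ).1
    -- a decoy: the answer is `true`
    have hd : ∑ σ ∈ Ad, (acceptProb (listFn K σ) (pairDist K σ) (.query x next) -
        acceptProb (cyclicFn K η σ) (pairDist K σ) (.query x next)) ≤
        Ad.card * ((P.card + 1 + 6 * r) / s) := by
      have htrue : ∀ σ ∈ Ad, listFn K σ x = true ∧ cyclicFn K η σ x = true := fun σ hσ =>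
        ⟨blockFn_of_decoy (mem_onesOf.1 hux) (Finset.mem_filter.1 hσ).2,
          blockFn_of_decoy (mem_onesOf.1 hux) (Finset.mem_filter.1 hσ).2⟩
      have := ih true Ad (insert u P) η
        (hA.filter_of_congr hPu _ fun σ τ h hσ => by
          rwa [← h u (Finset.mem_insert_self u P)])
        (fun σ hσ => (hH σ (hAdA σ hσ)).insert (Or.inl (Finset.mem_filter.1 hσ).2))
        (fun σ hσ => by
          have := hcost σ (hc σ (hAdA σ hσ))
          rwa [(htrue σ hσ).1] at this)
      rw [hcard] at this
      push_cast at this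
      refine le_trans (le_of_eq (Finset.sum_congr rfl fun σ hσ => ?_)) this
      rw [acceptProb_query, acceptProb_query, (htrue σ hσ).1, (htrue σ hσ).2]
    -- a variable in a block met before: the two functions may be told apart
    have hcb := sum_acceptProb_sub_le_card (K := K) Ac η fun _ => .query x next
    have hcard_le : Ac.card ≤
        (A.filter fun σ => ∃ i ∈ P, (σ i).val / 4 = (σ u).val / 4).card :=
      Finset.card_le_card fun σ hσ => by
        obtain ⟨h1, h2⟩ := Finset.mem_filter.1 hσ
        exact Finset.mem_filter.2 ⟨hBA σ h1, h2⟩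
    -- a variable in a new block: the next variable is revealed
    have hn := ihk An (insert u P) η
      (by
        have : onesOf x \ P = insert u (onesOf x \ insert u P) := by
          ext i
          simp only [Finset.mem_sdiff, Finset.mem_insert]
          by_cases h : i = u
          · subst h; simp [hux, huP]
          · simp [h]
        rw [this, Finset.card_insert_of_notMem (by simp)] at hk
        omega)
      ((hA.filter_of_congr hPu _ fun σ τ h hσ => by
          rwa [← h u (Finset.mem_insert_self u P)]).filter_of_congr subset_rfl _
        fun σ τ h hσ => by
          rintro ⟨i, hi, h'⟩
          refine hσ ⟨i, hi, ?_⟩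
          rw [h i (hPu hi), h u (Finset.mem_insert_self u P), h'])
      (fun σ hσ => (hH σ (hAnA σ hσ)).insert (Or.inr fun i hi h =>
        (Finset.mem_filter.1 hσ).2 ⟨i, hi, h⟩))
      (fun σ hσ => hc σ (hAnA σ hσ))
    rw [hcard] at hn
    push_cast at hn
    rw [← Finset.sum_filter_add_sum_filter_not A (fun σ => 4 * K ≤ (σ u).val), ← hB, ← hAd,
      ← Finset.sum_filter_add_sum_filter_not B
        (fun σ => ∃ i ∈ P, (σ i).val / 4 = (σ u).val / 4), ← hAc, ← hAn]
    have hAB : (Ad.card : ℝ) + (Ac.card + An.card) = A.card := by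
      have h1 := Finset.card_filter_add_card_filter_not (s := A) (fun σ => 4 * K ≤ (σ u).val)
      have h2 := Finset.card_filter_add_card_filter_not (s := B)
        (fun σ => ∃ i ∈ P, (σ i).val / 4 = (σ u).val / 4)
      rw [← hB, ← hAd] at h1
      rw [← hAc, ← hAn] at h2
      exact_mod_cast (by omega : Ad.card + (Ac.card + An.card) = A.card)
    have hmain := query_step_bound hs (p := P.card) (r := r) (by positivity) (by positivity)
      (by positivity) hAB.symm ((by gcongr : (Ac.card : ℝ) * s ≤ _).trans
        (hA.card_collision_mul_le hs hcol hP huP))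
      (hA.card_le_three_mul_card_decoy h8 hs hdec hP huP)
    linarith

/-- On the sets of permutations for which block `j` is not met by `P`, exchanging the labels `0`
and `3` of block `j` turns a sample of pair `1` of the twisted cyclic function into one of
pair `2`, and conversely. -/
theorem sum_acceptProb_retwist {n K : ℕ} [NeZero K] (hn : 4 * K ≤ n)
    {A : Finset (Equiv.Perm (Fin n))} {P : Finset (Fin n)} (hA : SwapClosed A P) (η : ℕ → Bool)
    (next : (Fin n → Bool) → DetAlg n) (j : Fin K) :
    ∑ t : Fin 4, ∑ σ ∈ A with ∀ i ∈ P, (σ i).val / 4 ≠ j.val,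
      acceptProb (cyclicFn K η σ) (pairDist K σ) (next (pairPoint σ (j, t))) =
    ∑ t : Fin 4, ∑ σ ∈ A with ∀ i ∈ P, (σ i).val / 4 ≠ j.val,
      acceptProb (cyclicFn K (retwist η j t) σ) (pairDist K σ) (next (pairPoint σ (j, t))) := by
  -- the left-hand sum over the pairs is reordered so that `1` and `2` change places
  rw [← Equiv.sum_comp (Equiv.swap (1 : Fin 4) 2)]
  refine Finset.sum_congr rfl fun t _ => ?_
  by_cases ht : t = 1 ∨ t = 2
  · have hmem : ∀ σ ∈ A.filter fun σ => ∀ i ∈ P, (σ i).val / 4 ≠ j.val,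
        slotSwap hn j * σ ∈ A.filter fun σ => ∀ i ∈ P, (σ i).val / 4 ≠ j.val := by
      intro σ hσ
      obtain ⟨h1, h2⟩ := Finset.mem_filter.1 hσ
      have hnot : ∀ ℓ, σ.symm (slot hn j ℓ) ∉ P := fun ℓ hP => h2 _ hP (by
        simp only [Equiv.apply_symm_apply, slot]; omega)
      refine Finset.mem_filter.2 ⟨?_, fun i hi => ?_⟩
      · have := hA σ h1 _ _ (hnot 0) (hnot 3)
        rwa [Equiv.mul_swap_eq_swap_mul, Equiv.apply_symm_apply, Equiv.apply_symm_apply] at this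
      · rw [Equiv.Perm.mul_apply, slotSwap_div]
        exact h2 i hi
    have hinv : ∀ σ : Equiv.Perm (Fin n), slotSwap hn j * (slotSwap hn j * σ) = σ := fun σ => by
      rw [← mul_assoc, slotSwap, Equiv.swap_mul_self, one_mul]
    refine Finset.sum_nbij' (fun σ => slotSwap hn j * σ) (fun σ => slotSwap hn j * σ) hmem hmem
      (fun σ _ => hinv σ) (fun σ _ => hinv σ) fun σ _ => ?_
    have hrt : retwist (fun j' => xor (η j') (decide (j' = j.val))) j t = η := by
      funext j'
      simp [retwist, ht]
    have hc : cyclicFn K (retwist η j t) (slotSwap hn j * σ) = cyclicFn K η σ := by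
      rw [cyclicFn_slotSwap_mul]
      congr 1
      funext j'
      simp [retwist, ht]
    have hrev : (Equiv.swap (1 : Fin 4) 2) t = t.rev := by
      rcases ht with rfl | rfl <;> rfl
    rw [hc, pairDist_slotSwap_mul, pairPoint_slotSwap_mul, if_pos rfl, hrev]
  · have hsw : (Equiv.swap (1 : Fin 4) 2) t = t :=
      Equiv.swap_apply_of_ne_of_ne (fun h => ht (Or.inl h)) (fun h => ht (Or.inr h))
    have hrt : retwist η j t = η := by
      funext j'
      simp [retwist, ht]
    rw [hsw, hrt]

/-- A sample from a block not met before leaves the two functions indistinguishable, with two more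
variables revealed. -/
theorem sum_acceptProb_sample_le {n K : ℕ} [NeZero K] {s : ℝ} (hn : 4 * K ≤ n) (hs : 0 < s)
    {next : (Fin n → Bool) → DetAlg n} {r : ℕ} (ih : ∀ x, Indistinguishable K s (next x) r)
    {A : Finset (Equiv.Perm (Fin n))} {P : Finset (Fin n)} {η : ℕ → Bool} (hA : SwapClosed A P)
    (hH : ∀ σ ∈ A, Hidden K σ P η)
    (hc : ∀ σ ∈ A, ∀ x, (next x).maxCost 1 1 (listFn K σ) ≤ r) (j : Fin K) (t : Fin 4)
    (hj : ∀ σ ∈ A, ∀ i ∈ P, (σ i).val / 4 ≠ j.val) :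
    ∑ σ ∈ A, (acceptProb (listFn K σ) (pairDist K σ) (next (pairPoint σ (j, t))) -
      acceptProb (cyclicFn K (retwist η j t) σ) (pairDist K σ) (next (pairPoint σ (j, t)))) ≤
      A.card * ((P.card + 2 + 6 * r) / s) := by
  rw [← Finset.sum_fiberwise A (fun σ => pairPoint σ (j, t))]
  have hx : ∀ x : Fin n → Bool, ∑ σ ∈ A with pairPoint σ (j, t) = x,
      (acceptProb (listFn K σ) (pairDist K σ) (next (pairPoint σ (j, t))) -
        acceptProb (cyclicFn K (retwist η j t) σ) (pairDist K σ)
          (next (pairPoint σ (j, t)))) ≤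
      (A.filter fun σ => pairPoint σ (j, t) = x).card * ((P.card + 2 + 6 * r) / s) := by
    intro x
    have h := ih x (A.filter fun σ => pairPoint σ (j, t) = x) (P ∪ onesOf x) (retwist η j t)
      (hA.filter Finset.subset_union_left _ fun σ u v hu hv hσ => by
        have hxu : x u = false := by
          simpa [mem_onesOf] using fun h => hu (Finset.mem_union_right _ h)
        have hxv : x v = false := by
          simpa [mem_onesOf] using fun h => hv (Finset.mem_union_right _ h)
        have : pairPoint (σ * Equiv.swap u v) (j, t) =
            fun i => pairPoint σ (j, t) (Equiv.swap u v i) := rfl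
        rw [this, hσ]
        funext i
        by_cases hiu : i = u
        · subst hiu; simp [hxu, hxv]
        · by_cases hiv : i = v
          · subst hiv; simp [hxu, hxv]
          · rw [Equiv.swap_apply_of_ne_of_ne hiu hiv])
      (fun σ hσ => by
        obtain ⟨h1, h2⟩ := Finset.mem_filter.1 hσ
        rw [← h2]
        exact (hH σ h1).union_pairPoint hn t (hj σ h1))
      (fun σ hσ => hc σ (Finset.mem_filter.1 hσ).1 x)
    refine le_trans (le_of_eq (Finset.sum_congr rfl fun σ hσ => ?_)) (h.trans ?_)
    · rw [(Finset.mem_filter.1 hσ).2]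
    · rcases (A.filter fun σ => pairPoint σ (j, t) = x).eq_empty_or_nonempty with h0 | ⟨σ, hσ⟩
      · simp [h0]
      · have h2 : (onesOf x).card ≤ 2 := by
          rw [← (Finset.mem_filter.1 hσ).2]
          exact card_onesOf_pairPoint_le hn σ _
        have h3 : ((P ∪ onesOf x).card : ℝ) ≤ P.card + 2 := by
          exact_mod_cast (Finset.card_union_le _ _).trans (Nat.add_le_add_left h2 _)
        gcongr
  refine (Finset.sum_le_sum fun x _ => hx x).trans (le_of_eq ?_)
  rw [← Finset.sum_mul, ← Nat.cast_sum, ← Finset.card_eq_sum_card_fiberwise (fun _ _ => by simp)]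

/-- Each permutation has at most `|P|` blocks that meet `P`. -/
theorem sum_card_block_met_le {n K : ℕ} (A : Finset (Equiv.Perm (Fin n))) (P : Finset (Fin n)) :
    ∑ j : Fin K, (A.filter fun σ => ¬ ∀ i ∈ P, (σ i).val / 4 ≠ j.val).card ≤
      A.card * P.card := by
  simp only [Finset.card_filter]
  rw [Finset.sum_comm, ← smul_eq_mul, ← Finset.sum_const]
  refine Finset.sum_le_sum fun σ _ => ?_
  rw [← Finset.card_filter]
  have : ((Finset.univ.filter fun j : Fin K => ¬ ∀ i ∈ P, (σ i).val / 4 ≠ j.val).image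
      Fin.val).card ≤ (P.image fun i => (σ i).val / 4).card := by
    refine Finset.card_le_card fun m hm => ?_
    obtain ⟨j, hj, rfl⟩ := Finset.mem_image.1 hm
    have := (Finset.mem_filter.1 hj).2
    push Not at this
    exact Finset.mem_image.2 this
  rw [Finset.card_image_of_injective _ Fin.val_injective] at this
  exact this.trans Finset.card_image_le

/-- One more sample costs at most `6 / s`: it reveals two variables, and its block was met before
with probability at most `4 / s`. -/
theorem Indistinguishable.sample {n K : ℕ} [NeZero K] {s : ℝ} (hn : 4 * K ≤ n) (hs : 0 < s)
    (hblk : s ^ 2 ≤ 4 * K) {next : (Fin n → Bool) → DetAlg n} {r : ℕ}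
    (ih : ∀ x, Indistinguishable K s (next x) r) :
    Indistinguishable K s (.sample next) (r + 1) := by
  intro A P η hA hH hc
  rcases le_or_gt s P.card with hP | hP
  · exact (sum_acceptProb_sub_le_card A η _).trans (card_le_card_mul_div hs hP (by positivity))
  have hc' : ∀ σ ∈ A, ∀ x, (next x).maxCost 1 1 (listFn K σ) ≤ r := by
    intro σ hσ x
    have h1 := hc σ hσ
    have h2 := Finset.le_sup (f := fun x => (next x).maxCost 1 1 (listFn K σ))
      (Finset.mem_univ x)
    rw [DetAlg.maxCost] at h1
    omega
  have hK : (0 : ℝ) < K := by exact_mod_cast NeZero.pos K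
  set b : ℝ := A.card * ((P.card + 2 + 6 * r) / s) with hb
  have hblock : ∀ j : Fin K, ∑ t : Fin 4, ∑ σ ∈ A,
      (acceptProb (listFn K σ) (pairDist K σ) (next (pairPoint σ (j, t))) -
        acceptProb (cyclicFn K η σ) (pairDist K σ) (next (pairPoint σ (j, t)))) ≤
      4 * ((A.filter fun σ => ¬ ∀ i ∈ P, (σ i).val / 4 ≠ j.val).card + b) := by
    intro j
    set F := A.filter fun σ => ∀ i ∈ P, (σ i).val / 4 ≠ j.val with hF
    set G := A.filter fun σ => ¬ ∀ i ∈ P, (σ i).val / 4 ≠ j.val with hG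
    have hsplit : ∀ t : Fin 4, ∑ σ ∈ A,
        (acceptProb (listFn K σ) (pairDist K σ) (next (pairPoint σ (j, t))) -
          acceptProb (cyclicFn K η σ) (pairDist K σ) (next (pairPoint σ (j, t)))) ≤
        G.card + (∑ σ ∈ F, acceptProb (listFn K σ) (pairDist K σ) (next (pairPoint σ (j, t))) -
          ∑ σ ∈ F, acceptProb (cyclicFn K η σ) (pairDist K σ)
            (next (pairPoint σ (j, t)))) := by
      intro t
      rw [← Finset.sum_filter_add_sum_filter_not A (fun σ => ∀ i ∈ P, (σ i).val / 4 ≠ j.val),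
        ← hF, ← hG, ← Finset.sum_sub_distrib, add_comm]
      gcongr
      exact sum_acceptProb_sub_le_card G η fun σ => next (pairPoint σ (j, t))
    have hfresh : ∀ t : Fin 4,
        ∑ σ ∈ F, acceptProb (listFn K σ) (pairDist K σ) (next (pairPoint σ (j, t))) -
          ∑ σ ∈ F, acceptProb (cyclicFn K (retwist η j t) σ) (pairDist K σ)
            (next (pairPoint σ (j, t))) ≤ b := by
      intro t
      rw [← Finset.sum_sub_distrib]
      refine (sum_acceptProb_sample_le hn hs ih
        (hA.filter_of_congr subset_rfl _ fun σ τ h hσ i hi => by rw [← h i hi]; exact hσ i hi)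
        (fun σ hσ => hH σ (Finset.mem_filter.1 hσ).1)
        (fun σ hσ => hc' σ (Finset.mem_filter.1 hσ).1) j t
        (fun σ hσ => (Finset.mem_filter.1 hσ).2)).trans ?_
      rw [hb]
      gcongr
      exact Finset.filter_subset _ _
    have hre := sum_acceptProb_retwist hn hA η next j
    rw [← hF] at hre
    calc _ ≤ ∑ t : Fin 4, ((G.card : ℝ) +
          (∑ σ ∈ F, acceptProb (listFn K σ) (pairDist K σ) (next (pairPoint σ (j, t))) -
            ∑ σ ∈ F, acceptProb (cyclicFn K η σ) (pairDist K σ)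
              (next (pairPoint σ (j, t))))) := Finset.sum_le_sum fun t _ => hsplit t
      _ = ∑ t : Fin 4, ((G.card : ℝ) +
          (∑ σ ∈ F, acceptProb (listFn K σ) (pairDist K σ) (next (pairPoint σ (j, t))) -
            ∑ σ ∈ F, acceptProb (cyclicFn K (retwist η j t) σ) (pairDist K σ)
              (next (pairPoint σ (j, t))))) := by
        rw [Finset.sum_add_distrib, Finset.sum_add_distrib, Finset.sum_sub_distrib,
          Finset.sum_sub_distrib, hre]
      _ ≤ ∑ t : Fin 4, ((G.card : ℝ) + b) :=
        Finset.sum_le_sum fun t _ => by linarith [hfresh t]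
      _ = _ := by simp [mul_add]
  have hmet : ∑ j : Fin K,
      ((A.filter fun σ => ¬ ∀ i ∈ P, (σ i).val / 4 ≠ j.val).card : ℝ) ≤ A.card * P.card := by
    exact_mod_cast sum_card_block_met_le A P
  have htotal : ∑ σ ∈ A, (acceptProb (listFn K σ) (pairDist K σ) (.sample next) -
      acceptProb (cyclicFn K η σ) (pairDist K σ) (.sample next)) =
      (∑ j : Fin K, ∑ t : Fin 4, ∑ σ ∈ A,
        (acceptProb (listFn K σ) (pairDist K σ) (next (pairPoint σ (j, t))) -
          acceptProb (cyclicFn K η σ) (pairDist K σ) (next (pairPoint σ (j, t))))) /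
        (4 * K) := by
    have : ∀ j : Fin K, ∑ t : Fin 4, ∑ σ ∈ A,
        (acceptProb (listFn K σ) (pairDist K σ) (next (pairPoint σ (j, t))) -
          acceptProb (cyclicFn K η σ) (pairDist K σ) (next (pairPoint σ (j, t)))) =
        ∑ σ ∈ A, ∑ t : Fin 4,
        (acceptProb (listFn K σ) (pairDist K σ) (next (pairPoint σ (j, t))) -
          acceptProb (cyclicFn K η σ) (pairDist K σ) (next (pairPoint σ (j, t)))) :=
      fun j => Finset.sum_comm
    simp only [this]
    rw [Finset.sum_comm, Finset.sum_div]
    refine Finset.sum_congr rfl fun σ _ => ?_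
    rw [acceptProb_sample, acceptProb_sample, ← sub_div, ← Finset.sum_sub_distrib]
    simp only [Finset.sum_sub_distrib]
  rw [htotal]
  have hsum : (∑ j : Fin K, ∑ t : Fin 4, ∑ σ ∈ A,
      (acceptProb (listFn K σ) (pairDist K σ) (next (pairPoint σ (j, t))) -
        acceptProb (cyclicFn K η σ) (pairDist K σ) (next (pairPoint σ (j, t))))) ≤
      4 * (A.card * P.card + K * b) := by
    refine (Finset.sum_le_sum fun j _ => hblock j).trans ?_
    rw [← Finset.mul_sum, Finset.sum_add_distrib, Finset.sum_const, Finset.card_univ,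
      Fintype.card_fin, nsmul_eq_mul]
    gcongr
  -- a block met before is sampled with probability at most `|P| / K`, hence at most `4 / s`
  have hPK : (P.card : ℝ) / K ≤ 4 / s := by
    rw [div_le_div_iff₀ hK hs]
    nlinarith
  calc _ ≤ 4 * (A.card * P.card + K * b) / (4 * K) := by gcongr
    _ = A.card * (P.card / K) + b := by field_simp
    _ ≤ A.card * (4 / s) + b := by gcongr
    _ = A.card * ((P.card + 6 * (r + 1 : ℕ)) / s) := by
      rw [hb]
      push_cast
      ring

/-- An algorithm of cost at most `r` distinguishes the two functions, for a random permutation,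
with advantage at most `6r / s`. -/
theorem indistinguishable {n K : ℕ} [NeZero K] {s : ℝ} (h8 : 8 * K ≤ n) (hs : 0 < s)
    (hcol : 4 * s ^ 2 ≤ n - s) (hdec : 4 * s ≤ n) (hblk : s ^ 2 ≤ 4 * K) (T : DetAlg n) :
    ∀ r, Indistinguishable K s T r := by
  -- an algorithm that takes a step has cost at least `1`, so `A` is empty if `r = 0`
  have hzero : ∀ T : DetAlg n, (∀ f, 1 ≤ T.maxCost 1 1 f) → Indistinguishable K s T 0 := by
    intro T hT A P η _ _ hc
    rcases A.eq_empty_or_nonempty with rfl | ⟨σ, hσ⟩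
    · simp
    · have := hc σ hσ
      have := hT (listFn K σ)
      omega
  induction T with
  | halt b =>
    intro r A P η _ _ _
    have : ∀ f D, acceptProb (n := n) f D (.halt b) = (PMF.pure b true).toReal := fun _ _ => rfl
    simp only [this, sub_self, Finset.sum_const_zero]
    positivity
  | sample next ih =>
    rintro (_ | r)
    · exact hzero _ fun f => by rw [DetAlg.maxCost]; omega
    · exact .sample (by omega) hs hblk fun x => ih x r
  | query q next ih =>
    rintro (_ | r)
    · exact hzero _ fun f => by rw [DetAlg.maxCost]; omega
    · exact .query h8 hs hcol hdec fun b => ih b r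

/-! ### Lower bounds for testers -/

theorem hidden_empty {n : ℕ} (K : ℕ) (σ : Equiv.Perm (Fin n)) :
    Hidden K σ ∅ (fun _ => false) := by
  refine ⟨fun j _ x hx => listRule_eq_cyclicRule_of_subsingleton _ _ fun ℓ ℓ' hℓ _ => ?_,
    fun _ _ => rfl⟩
  obtain ⟨i, hi, -⟩ := of_decide_eq_true hℓ
  exact absurd (hx i hi) (Finset.notMem_empty i)

theorem PMF.sum_bind_le_sum_bind_add {α β ι : Type*} (A : PMF α) (I : Finset ι)
    (F G : ι → α → PMF β) (b : β) {δ : ENNReal}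
    (h : ∀ a ∈ A.support, ∑ i ∈ I, F i a b ≤ ∑ i ∈ I, G i a b + δ) :
    ∑ i ∈ I, A.bind (F i) b ≤ ∑ i ∈ I, A.bind (G i) b + δ := by
  have hsum : ∀ H : ι → α → PMF β, ∑ i ∈ I, A.bind (H i) b = ∑' a, A a * ∑ i ∈ I, H i a b := by
    intro H
    simp only [PMF.bind_apply, Finset.mul_sum]
    rw [Summable.tsum_finsetSum fun i _ => ENNReal.summable]
  rw [hsum, hsum]
  calc ∑' a, A a * ∑ i ∈ I, F i a b ≤ ∑' a, (A a * ∑ i ∈ I, G i a b + A a * δ) := by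
        refine ENNReal.tsum_le_tsum fun a => ?_
        by_cases ha : a ∈ A.support
        · rw [← mul_add]
          exact mul_le_mul_right (h a ha) _
        · simp [(A.apply_eq_zero_iff a).2 ha]
    _ = ∑' a, A a * ∑ i ∈ I, G i a b + δ := by
        rw [ENNReal.tsum_add, ENNReal.tsum_mul_right, A.tsum_coe, one_mul]

theorem PMF.apply_true_le_one_third {D : PMF Bool} (h : 2 / 3 ≤ D false) : D true ≤ 1 / 3 := by
  have h1 := D.tsum_coe
  rw [tsum_bool] at h1
  have h2 : (2 / 3 : ENNReal) + D true ≤ 2 / 3 + 1 / 3 := by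
    calc (2 / 3 : ENNReal) + D true ≤ D false + D true := by gcongr
      _ = 2 / 3 + 1 / 3 := by
        rw [h1, ← ENNReal.add_div, show (2 : ENNReal) + 1 = 3 by norm_num,
          ENNReal.div_self (by norm_num) (by norm_num)]
  exact (ENNReal.add_le_add_iff_left (ENNReal.div_ne_top (by norm_num) (by norm_num))).1 h2

/-- An algorithm that separates a class containing the monotone decision lists from a class that
respects sums has cost at least `√n / 72`. -/
theorem sqrt_div_le_of_separates {n : ℕ} (hn : 8 ≤ n) {C C' : Set (BoolFn n)}
    (hC : MonoDL n ⊆ C) (hC' : RespectsSums C') {ε : ℝ} (hε : ε ≤ 1 / 4) {p : ENNReal}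
    (hp : 2 / 3 ≤ p) (A : RandAlg n) (t : ℕ) (hA : A.TotalAtMost t)
    (hsep : A.Separates C C' ε p) : Real.sqrt n / 72 ≤ t := by
  set K := n / 8 with hKdef
  have hK1 : 1 ≤ K := by omega
  have : NeZero K := ⟨by omega⟩
  have h8 : 8 * K ≤ n := by omega
  set s : ℝ := Real.sqrt n / 4 with hsdef
  have hn8 : (8 : ℝ) ≤ n := by exact_mod_cast hn
  have hsq : Real.sqrt n * Real.sqrt n = n := Real.mul_self_sqrt (Nat.cast_nonneg n)
  have hsqrt1 : 1 ≤ Real.sqrt n := Real.one_le_sqrt.2 (by linarith)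
  have hs : 0 < s := by positivity
  have hs2 : s ^ 2 = n / 16 := by rw [hsdef, div_pow, sq, hsq]; norm_num
  have hsn : Real.sqrt n ≤ n := by nlinarith
  have hK8 : (n : ℝ) ≤ 8 * K + 8 := by exact_mod_cast (by omega : n ≤ 8 * K + 8)
  have hK1' : (1 : ℝ) ≤ K := by exact_mod_cast hK1
  -- acceptance probabilities, summed over all permutations
  set I : Finset (Equiv.Perm (Fin n)) := Finset.univ with hI
  set δ : ℝ := I.card * ((0 + 6 * t) / s) with hδ
  have hδ0 : 0 ≤ δ := by positivity
  have hT : ∀ T ∈ A.support, ∑ σ ∈ I, T.run (listFn K σ) (pairDist K σ) true ≤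
      ∑ σ ∈ I, T.run (cyclicFn K (fun _ => false) σ) (pairDist K σ) true + ENNReal.ofReal δ := by
    intro T hT
    have h := indistinguishable (K := K) h8 hs (by rw [hs2]; linarith) (by linarith)
      (by rw [hs2]; linarith) T t I ∅ (fun _ => false) (fun σ _ _ _ _ _ => Finset.mem_univ _)
      (fun σ _ => hidden_empty K σ) (fun σ _ => hA T hT _)
    rw [Finset.sum_sub_distrib, Finset.card_empty, Nat.cast_zero, ← hδ] at h
    have e : ∀ f : Equiv.Perm (Fin n) → BoolFn n,
        ∑ σ ∈ I, T.run (f σ) (pairDist K σ) true =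
          ENNReal.ofReal (∑ σ ∈ I, acceptProb (f σ) (pairDist K σ) T) := by
      intro f
      rw [ENNReal.ofReal_sum_of_nonneg fun σ _ => acceptProb_nonneg _ _ _]
      exact Finset.sum_congr rfl fun σ _ => (ENNReal.ofReal_toReal (PMF.apply_ne_top _ _)).symm
    rw [e, e, ← ENNReal.ofReal_add (Finset.sum_nonneg fun σ _ => acceptProb_nonneg _ _ _) hδ0]
    exact ENNReal.ofReal_le_ofReal (by linarith)
  have hrun := PMF.sum_bind_le_sum_bind_add A I
    (fun σ T => T.run (listFn K σ) (pairDist K σ))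
    (fun σ T => T.run (cyclicFn K (fun _ => false) σ) (pairDist K σ)) true hT
  have hyes : ∀ σ ∈ I, (2 / 3 : ENNReal) ≤
      A.bind (fun T => T.run (listFn K σ) (pairDist K σ)) true := fun σ _ =>
    hp.trans ((hsep _ _).1 (hC (listFn_mem_monoDL K σ)))
  have hno : ∀ σ ∈ I, A.bind (fun T => T.run (cyclicFn K (fun _ => false) σ)
      (pairDist K σ)) true ≤ (1 / 3 : ENNReal) := fun σ _ =>
    PMF.apply_true_le_one_third
      (hp.trans ((hsep _ _).2 (isFar_cyclicFn (by omega) σ hC' hε)))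
  have hcmp : ENNReal.ofReal (I.card * (2 / 3)) ≤ ENNReal.ofReal (I.card * (1 / 3) + δ) := by
    have h1 : ENNReal.ofReal (2 / 3) = 2 / 3 := by
      rw [ENNReal.ofReal_div_of_pos (by norm_num)]; norm_num
    have h2 : ENNReal.ofReal (1 / 3) = 1 / 3 := by
      rw [ENNReal.ofReal_div_of_pos (by norm_num)]; norm_num
    rw [ENNReal.ofReal_add (by positivity) hδ0, ENNReal.ofReal_mul (by positivity),
      ENNReal.ofReal_mul (by positivity), ENNReal.ofReal_natCast, h1, h2, ← nsmul_eq_mul,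
      ← nsmul_eq_mul]
    exact (Finset.card_nsmul_le_sum _ _ _ hyes).trans
      (hrun.trans (by gcongr; exact Finset.sum_le_card_nsmul _ _ _ hno))
  rw [ENNReal.ofReal_le_ofReal_iff (by positivity)] at hcmp
  have hcard : (0 : ℝ) < I.card := by
    exact_mod_cast Finset.card_pos.2 ⟨1, Finset.mem_univ _⟩
  have h3 : (1 / 3 : ℝ) ≤ (0 + 6 * t) / s := by
    refine le_of_mul_le_mul_left ?_ hcard
    linarith
  rw [le_div_iff₀ hs] at h3
  linarith

theorem DetAlg.maxCost_one_one_le {n : ℕ} (f : BoolFn n) (T : DetAlg n) :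
    T.maxCost 1 1 f ≤ T.maxCost 1 0 f + T.maxCost 0 1 f := by
  induction T with
  | halt b => simp [DetAlg.maxCost]
  | sample next ih =>
    simp only [DetAlg.maxCost, zero_add]
    rw [add_assoc]
    refine Nat.add_le_add_left (Finset.sup_le fun x _ => (ih x).trans ?_) 1
    exact Nat.add_le_add
      (Finset.le_sup (f := fun x => (next x).maxCost 1 0 f) (Finset.mem_univ x))
      (Finset.le_sup (f := fun x => (next x).maxCost 0 1 f) (Finset.mem_univ x))
  | query q next ih =>
    have := ih (f q)
    simp only [DetAlg.maxCost]
    omega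

theorem RandAlg.SamplesAtMost.totalAtMost {n : ℕ} {A : RandAlg n} {m M : ℕ}
    (hm : A.SamplesAtMost m) (hM : A.QueriesAtMost M) : A.TotalAtMost (m + M) := fun T hT f =>
  (T.maxCost_one_one_le f).trans (Nat.add_le_add (hm T hT f) (hM T hT f))

theorem mainTheorem3 :
    ∃ c : ℝ, 0 < c ∧ ∃ N : ℕ, ∀ n : ℕ, N ≤ n → ∀ ε : ℝ, 0 < ε → ε ≤ 1 / 4 →
      (∀ (A : RandAlg n) (m M : ℕ), A.SamplesAtMost m → A.QueriesAtMost M →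
        A.Separates (MonoDL n) (LinearThresholdFns n) ε (5 / 6) →
        c * (Real.sqrt n / Real.log n) ≤ (m : ℝ) + (M : ℝ)) ∧
      (∀ (A : RandAlg n) (t : ℕ), A.TotalAtMost t →
        A.IsDistFreeTester (DecisionLists n) ε →
        c * (Real.sqrt n / Real.log n) ≤ (t : ℝ)) ∧
      (∀ (A : RandAlg n) (t : ℕ), A.TotalAtMost t →
        A.IsDistFreeTester (MonoDL n) ε →
        c * (Real.sqrt n / Real.log n) ≤ (t : ℝ)) := by
  refine ⟨1 / 72, by norm_num, 8, fun n hn ε _ hε => ?_⟩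
  have hlog : 1 ≤ Real.log n := by
    rw [Real.le_log_iff_exp_le (by positivity)]
    have : (8 : ℝ) ≤ n := by exact_mod_cast hn
    linarith [Real.exp_one_lt_d9]
  have hle : 1 / 72 * (Real.sqrt n / Real.log n) ≤ Real.sqrt n / 72 := by
    have := div_le_self (Real.sqrt_nonneg n) hlog
    linarith
  refine ⟨fun A m M hm hM h => ?_, fun A t ht h => ?_, fun A t ht h => ?_⟩
  · have h56 : (2 / 3 : ENNReal) ≤ 5 / 6 := by
      rw [← ENNReal.toReal_le_toReal (ENNReal.div_ne_top (by norm_num) (by norm_num))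
        (ENNReal.div_ne_top (by norm_num) (by norm_num))]
      norm_num
    exact_mod_cast hle.trans (sqrt_div_le_of_separates hn subset_rfl
      (respectsSums_linearThresholdFns n) hε h56 A (m + M) (hm.totalAtMost hM) h)
  · exact hle.trans (sqrt_div_le_of_separates hn (monoDL_subset_decisionLists n)
      (respectsSums_decisionLists n) hε le_rfl A t ht h)
  · exact hle.trans (sqrt_div_le_of_separates hn subset_rfl (respectsSums_monoDL n) hε le_rfl
      A t ht h)
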